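/- Let $w$ be a Schwartz function on $\mathbb R$ such that the functions $w_I(x)=|I|^{-1/2}\,w\big((x-c_I)/|I|\big)$, $I\in\mathcal D$, form a complete orthonormal system of $L_2(\mathbb R)$; here $\mathcal D$ is the collection of all dyadic intervals $[k2^n,(k+1)2^n)$ ($k,n\in\mathbb Z$) and $c_I$ is the center of $I$. Let $\mathcal M$ be a von Neumann algebra acting on a Hilbert space $K$, and write $|a|^2=a^*a$ for $a\in\mathcal M$. Let $L_\infty(\mathcal M;L_2^c(\mathbb R,\frac{dx}{1+x^2}))$ be the space of $\mathcal M$-valued $\varphi$ (given by their integrals $\int\varphi g\,\frac{dx}{1+x^2}\in\mathcal M$ against $g\in L_2(\mathbb R,\frac{dx}{1+x^2})$) for which $h\mapsto\varphi(\cdot)h$ is a bounded operator from $K$ to $L_2(\mathbb R,\frac{dx}{1+x^2};K)$, and let $L_\infty(\mathcal M;L_2^r(\mathbb R,\frac{dx}{1+x^2}))$ be the space of those $\varphi$ with $\varphi^*\in L_\infty(\mathcal M;L_2^c(\mathbb R,\frac{dx}{1+x^2}))$. Put $$\|\varphi\|_{\mathcal{BMO}^c}=\sup_{J\in\mathcal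 D}\Big\|\Big(\frac1{|J|}\sum_{I\in\mathcal D,\,I\subset J}|\langle\varphi,w_I\rangle|^2\Big)^{1/2}\Big\|_{\mathcal M},\qquad \langle\varphi,w_I\rangle=\int_{\mathbb R}\varphi(x)\,\overline{w_I(x)}\,dx,$$ $$\|\varphi\|_{BMO^c}=\sup_{I}\Big\|\Big(\frac1{|I|}\int_I|\varphi(x)-\varphi_I|^2dx\Big)^{1/2}\Big\|_{\mathcal M},\qquad \varphi_I=\frac1{|I|}\int_I\varphi(x)\,dx,$$ where the last supremum is over all bounded intervals $I\subset\mathbb R$ of positive length. These are seminorms. Let $\mathcal{BMO}^c(\mathbb R,\mathcal M)$ and $BMO^c(\mathbb R,\mathcal M)$ be the sets of all $\varphi\in L_\infty(\mathcal M;L_2^c(\mathbb R,\frac{dx}{1+x^2}))$ for which the corresponding quantity is finite. The row spaces $\mathcal{BMO}^r(\mathbb R,\mathcal M)$ and $BMO^r(\mathbb R,\mathcal M)$ are defined likewise inside $L_\infty(\mathcal M;L_2^r(\mathbb R,\frac{dx}{1+x^2}))$ by $\|\varphi\|_{\mathcal{BMO}^r}=\|\varphi^*\|_{\mathcal{BMO}^c}$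 and $\|\varphi\|_{BMO^r}=\|\varphi^*\|_{BMO^c}$. Finally let $\mathcal{BMO}(\mathbb R,\mathcal M)=\mathcal{BMO}^c(\mathbb R,\mathcal M)\cap\mathcal{BMO}^r(\mathbb R,\mathcal M)$ and $BMO(\mathbb R,\mathcal M)=BMO^c(\mathbb R,\mathcal M)\cap BMO^r(\mathbb R,\mathcal M)$, each with the maximum of its column and row norms. **Theorem.** One has $$\mathcal{BMO}^c(\mathbb R,\mathcal M)=BMO^c(\mathbb R,\mathcal M),\qquad \mathcal{BMO}^r(\mathbb R,\mathcal M)=BMO^r(\mathbb R,\mathcal M),\qquad \mathcal{BMO}(\mathbb R,\mathcal M)=BMO(\mathbb R,\mathcal M),$$ in each case with equivalent norms: there is a constant $c>0$, depending only on $w$ and not on $\mathcal M$, such that for every $\mathcal M$ and every $\varphi$ in the respective space each of the two norms of $\varphi$ is at most $c$ times the other. -/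

import Mathlib

open MeasureTheory
open scoped ENNReal NNReal InnerProductSpace SchwartzMap ComplexConjugate

universe u

noncomputable section

namespace OpBMO

/-! ### Dyadic intervals and wavelets -/

/-- The dyadic interval `[pos * 2 ^ scale, (pos + 1) * 2 ^ scale)`; the type is the collection
of all dyadic intervals of the real line. -/
@[ext]
structure DyadicInterval where
  scale : ℤ
  pos : ℤ

namespace DyadicInterval

/-- The length `|I|`. -/
def length (I : DyadicInterval) : ℝ := (2 : ℝ) ^ I.scale

/-- The centre `c_I`. -/
def center (I : DyadicInterval) : ℝ := ((I.pos : ℝ) + 1 / 2) * I.length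

/-- The interval as a subset of the line. -/
def toSet (I : DyadicInterval) : Set ℝ :=
  Set.Ico ((I.pos : ℝ) * I.length) (((I.pos : ℝ) + 1) * I.length)

lemma length_pos (I : DyadicInterval) : 0 < I.length := zpow_pos (by norm_num) _

end DyadicInterval

/-- `w_I(x) = |I|^{-1/2} w((x - c_I) / |I|)`. -/
def wavelet (w : 𝓢(ℝ, ℂ)) (I : DyadicInterval) (x : ℝ) : ℂ :=
  (((Real.sqrt I.length)⁻¹ : ℝ) : ℂ) * w ((x - I.center) / I.length)

lemma exists_schwartz_eq_wavelet (w : 𝓢(ℝ, ℂ)) (I : DyadicInterval) :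
    ∃ f : 𝓢(ℝ, ℂ), ∀ x, f x = wavelet w I x := by
  have hL := I.length_pos
  refine ⟨(((Real.sqrt I.length)⁻¹ : ℝ) : ℂ) • SchwartzMap.compCLMOfAntilipschitz ℂ
    (K := ⟨I.length, hL.le⟩) (g := fun x : ℝ => (x - I.center) / I.length) ?_ ?_ w, ?_⟩
  · simp only [div_eq_mul_inv]
    fun_prop
  · refine AntilipschitzWith.of_le_mul_dist fun x y => ?_
    rw [Real.dist_eq, Real.dist_eq, ← sub_div, sub_sub_sub_cancel_right, abs_div,
      abs_of_pos hL]
    change _ ≤ I.length * _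
    rw [mul_div_cancel₀ _ hL.ne']
  · intro x
    rfl

lemma memLp_wavelet (w : 𝓢(ℝ, ℂ)) (I : DyadicInterval) :
    MemLp (wavelet w I) 2 (volume : Measure ℝ) := by
  obtain ⟨f, hf⟩ := exists_schwartz_eq_wavelet w I
  rw [← funext hf]
  exact f.memLp 2 volume

/-- `w_I` as an element of `L²(ℝ)`. -/
def waveletL2 (w : 𝓢(ℝ, ℂ)) (I : DyadicInterval) : Lp ℂ 2 (volume : Measure ℝ) :=
  (memLp_wavelet w I).toLp _

/-- The Schwartz function `w` generates a wavelet basis of `L²(ℝ)`: the family `(w_I)`, indexed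
by all dyadic intervals, is a complete orthonormal system. -/
def IsWaveletBasis (w : 𝓢(ℝ, ℂ)) : Prop :=
  Orthonormal ℂ (waveletL2 w) ∧
    (Submodule.span ℂ (Set.range (waveletL2 w))).topologicalClosure = ⊤

/-! ### The weight `dx / (1 + x²)` -/

/-- The measure `dx / (1 + x²)` on the line. -/
def wMeasure : Measure ℝ := volume.withDensity fun x => ENNReal.ofReal (1 + x ^ 2)⁻¹

instance : IsFiniteMeasure wMeasure :=
  isFiniteMeasure_withDensity_ofReal integrable_inv_one_add_sq.2

/-- The scalar space `L²(ℝ, dx / (1 + x²))`. -/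
abbrev L2w : Type := Lp ℂ 2 wMeasure

lemma memLp_weight_wavelet (w : 𝓢(ℝ, ℂ)) (I : DyadicInterval) :
    MemLp (fun x : ℝ => ((1 + x ^ 2 : ℝ) : ℂ) * conj (wavelet w I x)) 2 wMeasure := by
  obtain ⟨f, hf⟩ := exists_schwartz_eq_wavelet w I
  simp_rw [← hf]
  obtain ⟨C0, hC0⟩ := f.decay 0 0
  obtain ⟨C2, hC2⟩ := f.decay 2 0
  refine MemLp.of_bound (Continuous.aestronglyMeasurable ?_) (C0 + C2) (ae_of_all _ fun x => ?_)
  · have := f.continuous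
    fun_prop
  · have h0 := hC0.2 x
    have h2 := hC2.2 x
    simp only [pow_zero, one_mul, norm_iteratedFDeriv_zero, Real.norm_eq_abs, sq_abs] at h0 h2
    rw [norm_mul, RCLike.norm_conj, Complex.norm_real, Real.norm_eq_abs,
      abs_of_pos (by positivity)]
    linarith

lemma memLp_weight_indicator (a b : ℝ) :
    MemLp (fun x : ℝ => ((1 + x ^ 2 : ℝ) : ℂ) * (Set.Ioc a b).indicator 1 x) 2 wMeasure := by
  refine MemLp.of_bound (Measurable.aestronglyMeasurable ?_) (1 + a ^ 2 + b ^ 2)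
    (ae_of_all _ fun x => ?_)
  · have : Measurable ((Set.Ioc a b).indicator (1 : ℝ → ℂ)) :=
      measurable_one.indicator measurableSet_Ioc
    fun_prop
  · by_cases hx : x ∈ Set.Ioc a b
    · rw [Set.indicator_of_mem hx, Pi.one_apply, mul_one, Complex.norm_real, Real.norm_eq_abs,
        abs_of_pos (by positivity)]
      obtain ⟨h1, h2⟩ := hx
      rcases le_total 0 x with h | h <;> nlinarith
    · rw [Set.indicator_of_notMem hx]
      simp only [mul_zero, norm_zero]
      positivity

/-! ### `M`-valued functions on the line -/

section Functions

variable {K : Type u} [NormedAddCommGroup K] [InnerProductSpace ℂ K] [CompleteSpace K]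

/-- The common ambient space: weak `M`-valued functions `φ` on the line.  Such a `φ` is given by
its integrals `φ g = ∫ φ(x) g(x) dx / (1 + x²) ∈ M`, depending continuously on
`g ∈ L²(ℝ, dx / (1 + x²))`. -/
def WeakFun (M : VonNeumannAlgebra K) : Submodule ℂ (L2w →L[ℂ] (K →L[ℂ] K)) where
  carrier := {φ | ∀ g, φ g ∈ M}
  add_mem' := fun h h' g => add_mem (h g) (h' g)
  zero_mem' := fun _ => zero_mem M
  smul_mem' := fun c _ h g => M.toStarSubalgebra.smul_mem (h g) c

lemma L2w_star_add (f g : L2w) : star (f + g) = star f + star g := by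
  apply Lp.ext
  filter_upwards [Lp.coeFn_star (f + g), Lp.coeFn_star f, Lp.coeFn_star g, Lp.coeFn_add f g,
    Lp.coeFn_add (star f) (star g)] with x h1 h2 h3 h4 h5
  simp only [h1, h2, h3, h4, h5, Pi.star_apply, Pi.add_apply, star_add]

lemma L2w_star_smul (c : ℂ) (f : L2w) : star (c • f) = star c • star f := by
  apply Lp.ext
  filter_upwards [Lp.coeFn_star (c • f), Lp.coeFn_star f, Lp.coeFn_smul c f,
    Lp.coeFn_smul (star c) (star f)] with x h1 h2 h3 h4
  simp only [h1, h2, h3, h4, Pi.star_apply, Pi.smul_apply, star_smul]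

lemma L2w_norm_star (f : L2w) : ‖star f‖ = ‖f‖ := by
  rw [Lp.norm_def, Lp.norm_def]
  congr 1
  refine eLpNorm_congr_norm_ae ?_
  filter_upwards [Lp.coeFn_star f] with x h
  simp [h]

/-- The adjoint function `φ*(x) = φ(x)*`, that is `∫ φ* g = (∫ φ ḡ)*`. -/
def adj {M : VonNeumannAlgebra K} (φ : WeakFun M) : WeakFun M :=
  ⟨LinearMap.mkContinuous
    { toFun := fun g => star (φ.1 (star g))
      map_add' := fun f g => by rw [L2w_star_add, map_add, star_add]
      map_smul' := fun c f => by
        rw [L2w_star_smul, map_smul, star_smul, star_star, RingHom.id_apply] }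
    ‖φ.1‖ fun g => by
      change ‖star (φ.1 (star g))‖ ≤ _
      rw [norm_star, ← L2w_norm_star g]
      exact φ.1.le_opNorm _,
  fun g => star_mem (φ.2 (star g))⟩

/-- The bounded operator `T : K → L²(ℝ, dx / (1 + x²); K)` is the column of `φ`, that is
`(T h)(x) = φ(x) h`, expressed through the integrals of both sides. -/
def IsColumn {M : VonNeumannAlgebra K} (φ : WeakFun M) (T : K →L[ℂ] Lp K 2 wMeasure) : Prop :=
  ∀ (g : L2w) (h : K), φ.1 g h = ∫ x, g x • T h x ∂wMeasure

lemma IsColumn.unique {M : VonNeumannAlgebra K} {φ : WeakFun M} {T T' : K →L[ℂ] Lp K 2 wMeasure}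
    (hT : IsColumn φ T) (hT' : IsColumn φ T') : T = T' := by
  ext1 h
  have hi : ∀ f : Lp K 2 wMeasure, Integrable f wMeasure := fun f =>
    (Lp.memLp f).integrable (by norm_num)
  apply Lp.ext
  refine Integrable.ae_eq_of_forall_setIntegral_eq _ _ (hi _) (hi _) fun s hs _ => ?_
  have key : ∀ f : Lp K 2 wMeasure,
      ∫ x, (indicatorConstLp 2 hs (measure_ne_top wMeasure s) (1 : ℂ) : L2w) x • f x ∂wMeasure
        = ∫ x in s, f x ∂wMeasure := by
    intro f
    rw [← integral_indicator hs]
    refine integral_congr_ae ?_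
    filter_upwards [indicatorConstLp_coeFn (p := 2) (hs := hs)
      (hμs := measure_ne_top wMeasure s) (c := (1 : ℂ))] with x hx
    rw [hx]
    by_cases hxs : x ∈ s <;> simp [hxs]
  rw [← key, ← key, ← hT, ← hT']

/-- The column space `L_∞(M; L₂ᶜ(ℝ, dx / (1 + x²)))`, that is, the first column of
`M ⊗̄ B(L²(ℝ, dx / (1 + x²)))`: the `M`-valued `φ` for which `h ↦ φ(·) h` is a bounded operator
from `K` to `L²(ℝ, dx / (1 + x²); K)`. -/
def columnL2 (M : VonNeumannAlgebra K) : Set (WeakFun M) := {φ | ∃ T, IsColumn φ T}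

/-- The row space `L_∞(M; L₂ʳ(ℝ, dx / (1 + x²)))`. -/
def rowL2 (M : VonNeumannAlgebra K) : Set (WeakFun M) := {φ | adj φ ∈ columnL2 M}

open Classical in
/-- The unique operator `h ↦ φ(·) h` of an element `φ` of the column space (and `0` for other
`φ`, a value that is never used). -/
def columnOp {M : VonNeumannAlgebra K} (φ : WeakFun M) : K →L[ℂ] Lp K 2 wMeasure :=
  if h : φ ∈ columnL2 M then h.choose else 0

lemma columnOp_spec {M : VonNeumannAlgebra K} {φ : WeakFun M} (h : φ ∈ columnL2 M) :
    IsColumn φ (columnOp φ) := by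
  rw [columnOp, dif_pos h]
  exact h.choose_spec

/-! ### The wavelet norm -/

/-- The wavelet coefficient `⟨φ, w_I⟩ = ∫ φ(x) conj (w_I(x)) dx ∈ M`. -/
def coeff {M : VonNeumannAlgebra K} (w : 𝓢(ℝ, ℂ)) (φ : WeakFun M) (I : DyadicInterval) :
    K →L[ℂ] K :=
  φ.1 ((memLp_weight_wavelet w I).toLp _)

/-- `sup_J ‖((1 / |J|) ∑_{I ⊆ J} |⟨φ, w_I⟩|²)^{1/2}‖` with `|a|² = a* a`.  The norm of the (possibly
infinite) sum of positive operators is the supremum over its finite partial sums. -/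
def waveletNormC {M : VonNeumannAlgebra K} (w : 𝓢(ℝ, ℂ)) (φ : WeakFun M) : ℝ≥0∞ :=
  ⨆ (J : DyadicInterval) (F : Finset DyadicInterval) (_ : ∀ I ∈ F, I.toSet ⊆ J.toSet),
    ‖CFC.sqrt (J.length⁻¹ • ∑ I ∈ F, star (coeff w φ I) * coeff w φ I)‖ₑ

/-- The row norm `‖φ‖ = ‖φ*‖_c`. -/
def waveletNormR {M : VonNeumannAlgebra K} (w : 𝓢(ℝ, ℂ)) (φ : WeakFun M) : ℝ≥0∞ :=
  waveletNormC w (adj φ)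

/-- The norm of the intersection of the column and the row space. -/
def waveletNorm {M : VonNeumannAlgebra K} (w : 𝓢(ℝ, ℂ)) (φ : WeakFun M) : ℝ≥0∞ :=
  max (waveletNormC w φ) (waveletNormR w φ)

/-- The wavelet column `BMO` space. -/
def waveletBMOC (w : 𝓢(ℝ, ℂ)) (M : VonNeumannAlgebra K) : Set (WeakFun M) :=
  {φ | φ ∈ columnL2 M ∧ waveletNormC w φ < ∞}

/-- The wavelet row `BMO` space. -/
def waveletBMOR (w : 𝓢(ℝ, ℂ)) (M : VonNeumannAlgebra K) : Set (WeakFun M) :=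
  {φ | φ ∈ rowL2 M ∧ waveletNormR w φ < ∞}

/-- The wavelet `BMO` space. -/
def waveletBMO (w : 𝓢(ℝ, ℂ)) (M : VonNeumannAlgebra K) : Set (WeakFun M) :=
  waveletBMOC w M ∩ waveletBMOR w M

/-! ### The mean oscillation norm -/

lemma restrict_Ioc_le (a b : ℝ) :
    volume.restrict (Set.Ioc a b) ≤ ENNReal.ofReal (1 + a ^ 2 + b ^ 2) • wMeasure := by
  refine Measure.le_iff.2 fun s hs => ?_
  rw [Measure.restrict_apply hs, Measure.smul_apply, smul_eq_mul, wMeasure,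
    withDensity_apply _ hs, ← lintegral_const_mul _ (by fun_prop), ← setLIntegral_one]
  refine le_trans (setLIntegral_mono' (hs.inter measurableSet_Ioc) fun x hx => ?_)
    (lintegral_mono_set Set.inter_subset_left)
  rw [← ENNReal.ofReal_mul (by positivity), ← ENNReal.ofReal_one]
  refine ENNReal.ofReal_le_ofReal ?_
  rw [← div_eq_mul_inv, one_le_div (by positivity)]
  obtain ⟨h1, h2⟩ := hx.2
  rcases le_total 0 x with h | h <;> nlinarith

lemma memLp_restrict_Ioc (f : Lp K 2 wMeasure) (a b : ℝ) :
    MemLp f 2 (volume.restrict (Set.Ioc a b)) :=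
  (Lp.memLp f).of_measure_le_smul ENNReal.ofReal_ne_top (restrict_Ioc_le a b)

lemma ac_restrict_Ioc (a b : ℝ) : volume.restrict (Set.Ioc a b) ≪ wMeasure :=
  (Measure.absolutelyContinuous_of_le (restrict_Ioc_le a b)).trans
    Measure.smul_absolutelyContinuous

/-- Restriction of functions to the interval `(a, b]`, with values in the unweighted `L²`. -/
def restrictL2 (a b : ℝ) : Lp K 2 wMeasure →L[ℂ] Lp K 2 (volume.restrict (Set.Ioc a b)) :=
  LinearMap.mkContinuous
    { toFun := fun f => (memLp_restrict_Ioc f a b).toLp f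
      map_add' := fun f g => by
        rw [← MemLp.toLp_add, MemLp.toLp_eq_toLp_iff]
        exact (ac_restrict_Ioc a b).ae_le (Lp.coeFn_add f g)
      map_smul' := fun c f => by
        rw [RingHom.id_apply, ← MemLp.toLp_const_smul, MemLp.toLp_eq_toLp_iff]
        exact (ac_restrict_Ioc a b).ae_le (Lp.coeFn_smul c f) }
    ((ENNReal.ofReal (1 + a ^ 2 + b ^ 2) ^ (1 / (2 : ℝ≥0∞)).toReal).toReal) fun f => by
      change ‖(memLp_restrict_Ioc f a b).toLp f‖ ≤ _
      rw [Lp.norm_toLp, Lp.norm_def, ← ENNReal.toReal_mul]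
      refine ENNReal.toReal_mono
        (ENNReal.mul_ne_top (by finiteness) (Lp.eLpNorm_ne_top f)) ?_
      exact eLpNorm_le_of_measure_le_smul (restrict_Ioc_le a b)

/-- The mean `φ_I = (1 / |I|) ∫_I φ(x) dx ∈ M` over `I = (a, b]`. -/
def mean {M : VonNeumannAlgebra K} (φ : WeakFun M) (a b : ℝ) : K →L[ℂ] K :=
  (b - a)⁻¹ • φ.1 ((memLp_weight_indicator a b).toLp _)

/-- The column `h ↦ (φ(·) - φ_I) h` of `φ - φ_I` on `I = (a, b]`, with values in `L²(I, dx; K)`. -/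
def oscOp {M : VonNeumannAlgebra K} (φ : WeakFun M) (a b : ℝ) :
    K →L[ℂ] Lp K 2 (volume.restrict (Set.Ioc a b)) :=
  restrictL2 a b ∘L columnOp φ - Lp.constL 2 (volume.restrict (Set.Ioc a b)) ℂ ∘L mean φ a b

/-- The operator `∫_I |φ(x) - φ_I|² dx` with `|a|² = a* a`, over `I = (a, b]`: its quadratic form
is `h ↦ ∫_I ‖(φ(x) - φ_I) h‖² dx`. -/
def oscSq {M : VonNeumannAlgebra K} (φ : WeakFun M) (a b : ℝ) : K →L[ℂ] K :=
  ContinuousLinearMap.adjoint (oscOp φ a b) ∘L oscOp φ a b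

/-- `sup_I ‖((1 / |I|) ∫_I |φ(x) - φ_I|² dx)^{1/2}‖` over all bounded intervals `I`. -/
def oscNormC {M : VonNeumannAlgebra K} (φ : WeakFun M) : ℝ≥0∞ :=
  ⨆ (a : ℝ) (b : ℝ) (_ : a < b), ‖CFC.sqrt ((b - a)⁻¹ • oscSq φ a b)‖ₑ

/-- The row norm `‖φ‖ = ‖φ*‖_c`. -/
def oscNormR {M : VonNeumannAlgebra K} (φ : WeakFun M) : ℝ≥0∞ := oscNormC (adj φ)

/-- The norm of the intersection of the column and the row space. -/
def oscNorm {M : VonNeumannAlgebra K} (φ : WeakFun M) : ℝ≥0∞ :=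
  max (oscNormC φ) (oscNormR φ)

/-- The mean oscillation column `BMO` space. -/
def oscBMOC (M : VonNeumannAlgebra K) : Set (WeakFun M) :=
  {φ | φ ∈ columnL2 M ∧ oscNormC φ < ∞}

/-- The mean oscillation row `BMO` space. -/
def oscBMOR (M : VonNeumannAlgebra K) : Set (WeakFun M) :=
  {φ | φ ∈ rowL2 M ∧ oscNormR φ < ∞}

/-- The mean oscillation `BMO` space. -/
def oscBMO (M : VonNeumannAlgebra K) : Set (WeakFun M) := oscBMOC M ∩ oscBMOR M

end Functions

end OpBMO

end

namespace OpBMO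

open Filter Topology

/-! ### Decay and cancellation of the wavelets -/

/-! Both norms are read off from single vectors. For a positive operator `T` one has `⟨T h, h⟩ = ‖√T
h‖²`, so a bound on the norm of `√T` is a bound on the quadratic form of `T`. For `φ` in the column
space and `h ∈ K`, put `f = φ(·) h`, a `K`-valued function that is square integrable against `dx /
(1 + x²)`. The quadratic form of the wavelet norm is then a sum of `‖⟨f, w_I⟩‖²`, and that of the
other norm is the mean square oscillation of `f`. What remains is the classical equivalence of
Carleson condition and bounded mean oscillation for Hilbert space valued `f`, with constants
depending on `w` alone. Its tools are Parseval's identity in `L²(ℝ; K)`, the decay and smoothness of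
`w`, and `∫ w = 0`, which orthogonality across scales forces.

Oscillation bounds coefficients (`exists_carleson_le_osc`): for fixed `J` subtract the mean of `f`
over the double of `J`, which no coefficient sees. The part inside the double is controlled by
Parseval. The part outside is controlled by the decay of `w_I` and the slow growth of means under
doubling; its coefficients are of order `(|I|³ / |J|²)^{1/2}`, and the squares sum over `I ⊆ J` to a
multiple of `|J|`.

Coefficients bound oscillation (`exists_osc_le_carleson`): this is duality against `F = 1_{(a,b]} (f
- m)`, with `m` the mean of `f` over `(a, b]`. As `F` has mean zero, `Q = ∫ ‖F‖²` equals `∫ ⟨F, f⟩ =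
∑ ⟨F_I, f_I⟩`, where `F_I`, `f_I` are the coefficients. Short intervals near `(a, b]` are handled by
Cauchy–Schwarz and the Carleson condition. For the others `‖f_I‖ ≤ A |I|^{1/2}` suffices, because
`F_I` is small by decay or by cancellation. This yields `Q ≤ C A (b - a)^{1/2} Q^{1/2}`. The
delicate point is the reproducing formula `hasSum_inner_vcoeff_of_local`, since `f` need not lie in
`L²(dx)`. -/

lemma exists_decay (w : 𝓢(ℝ, ℂ)) : ∃ C : ℝ, 0 < C ∧
    (∀ x, ‖w x‖ ≤ C * ((1 + |x|) ^ 6)⁻¹) ∧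
    ∀ x y, |x - y| ≤ 1 → ‖w x - w y‖ ≤ C * |x - y| * ((1 + |x|) ^ 6)⁻¹ := by
  set S : ℝ := 2 ^ 6 * (Finset.Iic ((6, 1) : ℕ × ℕ)).sup (fun m => SchwartzMap.seminorm ℝ m.1 m.2) w
    with hS
  have hS0 : 0 ≤ S := by positivity
  have h0 : ∀ x, ‖w x‖ ≤ S * ((1 + |x|) ^ 6)⁻¹ := by
    intro x
    have := SchwartzMap.one_add_le_sup_seminorm_apply (𝕜 := ℝ) (m := (6, 1)) (k := 6) (n := 0)
      le_rfl (by norm_num) w x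
    rw [norm_iteratedFDeriv_zero, Real.norm_eq_abs] at this
    rw [← div_eq_mul_inv, le_div_iff₀ (by positivity), mul_comm]
    exact this
  have h1 : ∀ x, ‖deriv w x‖ ≤ S * ((1 + |x|) ^ 6)⁻¹ := by
    intro x
    have := SchwartzMap.one_add_le_sup_seminorm_apply (𝕜 := ℝ) (m := (6, 1)) (k := 6) (n := 1)
      le_rfl le_rfl w x
    rw [norm_iteratedFDeriv_one, Real.norm_eq_abs, ← norm_deriv_eq_norm_fderiv] at this
    rw [← div_eq_mul_inv, le_div_iff₀ (by positivity), mul_comm]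
    exact this
  -- The new factor `2 ^ 6` pays for replacing `z` by `x` in the decay of the derivative: `1 + |x| ≤
  -- 2 (1 + |z|)` when `|z - x| ≤ 1`. The summand `1` secures positivity.
  refine ⟨2 ^ 6 * S + 1, by positivity, fun x => (h0 x).trans ?_, fun x y hxy => ?_⟩
  · gcongr
    nlinarith
  · have hd : ∀ z ∈ Set.uIcc x y, ‖deriv w z‖ ≤ (2 ^ 6 * S + 1) * ((1 + |x|) ^ 6)⁻¹ := by
      intro z hz
      have hzx : |z - x| ≤ 1 := (Set.abs_sub_left_of_mem_uIcc hz).trans (by rwa [abs_sub_comm])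
      have hz1 : (1 + |x|) / 2 ≤ 1 + |z| := by
        have := abs_sub_abs_le_abs_sub x z
        rw [abs_sub_comm] at this
        have := abs_nonneg z
        linarith
      calc ‖deriv w z‖ ≤ S * ((1 + |z|) ^ 6)⁻¹ := h1 z
        _ ≤ S * (((1 + |x|) / 2) ^ 6)⁻¹ := by gcongr
        _ = (2 ^ 6 * S) * ((1 + |x|) ^ 6)⁻¹ := by rw [div_pow, inv_div]; ring
        _ ≤ _ := by gcongr; linarith
    have := (convex_uIcc x y).norm_image_sub_le_of_norm_deriv_le (f := w)
      (fun z _ => w.differentiableAt) hd Set.right_mem_uIcc Set.left_mem_uIcc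
    rw [Real.norm_eq_abs] at this
    linarith [this]

lemma continuous_wavelet (w : 𝓢(ℝ, ℂ)) (I : DyadicInterval) : Continuous (wavelet w I) := by
  have := w.continuous
  unfold wavelet
  fun_prop

/-- The distance from `a` to the centre of `I` in units of `|I|`. -/
noncomputable def DyadicInterval.relDist (I : DyadicInterval) (a : ℝ) : ℝ := |(a - I.center) / I.length|

lemma DyadicInterval.relDist_nonneg (I : DyadicInterval) (a : ℝ) : 0 ≤ I.relDist a := abs_nonneg _

lemma DyadicInterval.relDist_eq (I : DyadicInterval) (a : ℝ) :
    I.relDist a = |a - I.center| / I.length := by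
  rw [relDist, abs_div, abs_of_pos I.length_pos]

lemma norm_wavelet_le {w : 𝓢(ℝ, ℂ)} {C : ℝ} (hC : ∀ x, ‖w x‖ ≤ C * ((1 + |x|) ^ 6)⁻¹)
    (I : DyadicInterval) (x : ℝ) :
    ‖wavelet w I x‖ ≤ C * (Real.sqrt I.length)⁻¹ * ((1 + I.relDist x) ^ 6)⁻¹ := by
  have := hC ((x - I.center) / I.length)
  rw [wavelet, norm_mul, Complex.norm_real, Real.norm_of_nonneg (by positivity), mul_comm C, mul_assoc]
  gcongr
  exact this

lemma norm_wavelet_sub_le {w : 𝓢(ℝ, ℂ)} {C : ℝ}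
    (hC : ∀ x y, |x - y| ≤ 1 → ‖w x - w y‖ ≤ C * |x - y| * ((1 + |x|) ^ 6)⁻¹)
    (I : DyadicInterval) {a x : ℝ} (h : |a - x| ≤ I.length) :
    ‖wavelet w I a - wavelet w I x‖ ≤
      C * (Real.sqrt I.length)⁻¹ * (|a - x| / I.length) * ((1 + I.relDist a) ^ 6)⁻¹ := by
  have hl := I.length_pos
  have e : (a - I.center) / I.length - (x - I.center) / I.length = (a - x) / I.length := by ring
  have e2 : |(a - x) / I.length| = |a - x| / I.length := by rw [abs_div, abs_of_pos hl]
  have := hC ((a - I.center) / I.length) ((x - I.center) / I.length)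
    (by rw [e, e2, div_le_one hl]; exact h)
  rw [e, e2] at this
  rw [wavelet, wavelet, ← mul_sub, norm_mul, Complex.norm_real, Real.norm_of_nonneg (by positivity),
    mul_comm C, mul_assoc, mul_assoc, ← mul_assoc C]
  gcongr
  exact this

/-- Orthonormality of a wavelet basis in terms of integrals. -/
lemma IsWaveletBasis.integral_conj_mul [DecidableEq DyadicInterval] {w : 𝓢(ℝ, ℂ)} (hw : IsWaveletBasis w)
    (I J : DyadicInterval) :
    ∫ x, conj (wavelet w I x) * wavelet w J x = if I = J then 1 else 0 := by
  rw [← (orthonormal_iff_ite.1 hw.1) I J, L2.inner_def]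
  refine integral_congr_ae ?_
  filter_upwards [(memLp_wavelet w I).coeFn_toLp, (memLp_wavelet w J).coeFn_toLp] with x h1 h2
  rw [waveletL2, waveletL2, h1, h2, RCLike.inner_apply, mul_comm]

lemma exists_dyadic_near (x : ℝ) (n : ℤ) :
    ∃ I : DyadicInterval, I.scale = n ∧ |x - I.center| ≤ I.length := by
  refine ⟨⟨n, ⌊x / (2 : ℝ) ^ n⌋⟩, rfl, ?_⟩
  have hl : (0 : ℝ) < 2 ^ n := zpow_pos (by norm_num) _
  have h1 := Int.floor_le (x / (2 : ℝ) ^ n)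
  have h2 := Int.lt_floor_add_one (x / (2 : ℝ) ^ n)
  rw [le_div_iff₀ hl] at h1
  rw [div_lt_iff₀ hl] at h2
  simp only [DyadicInterval.center, DyadicInterval.length]
  rw [abs_le]
  constructor <;> nlinarith

/-- The functions of a smooth wavelet basis have mean zero. -/
lemma IsWaveletBasis.integral_eq_zero {w : 𝓢(ℝ, ℂ)} (hw : IsWaveletBasis w) : ∫ x, w x = 0 := by
  classical
  by_contra hne
  obtain ⟨x0, hx0⟩ : ∃ x, w x ≠ 0 := by
    by_contra! h
    exact hne (by simp [h])
  -- The wavelet of `⟨0, 0⟩` is `w(x - 1/2)`, so centres tending to `x0 + 1/2` make it close to `w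
  -- x0` where `w_{I n}` concentrates. The scales are negative, hence `I n ≠ ⟨0, 0⟩` and the two
  -- wavelets are orthogonal.
  choose I hI hIx using fun n : ℕ => exists_dyadic_near (x0 + 1 / 2) (-(n + 1 : ℤ))
  have hlen : ∀ n, (I n).length = ((2 : ℝ)⁻¹) ^ (n + 1) := by
    intro n
    rw [DyadicInterval.length, hI, zpow_neg, inv_pow]
    norm_cast
  have hlen0 : Tendsto (fun n => (I n).length) atTop (𝓝 0) := by
    simp_rw [hlen]
    exact (tendsto_pow_atTop_nhds_zero_of_lt_one (by norm_num) (by norm_num)).comp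
      (tendsto_add_atTop_nat 1)
  have hcen : Tendsto (fun n => (I n).center) atTop (𝓝 (x0 + 1 / 2)) := by
    refine tendsto_iff_norm_sub_tendsto_zero.2 (squeeze_zero (fun _ => norm_nonneg _) (fun n => ?_) hlen0)
    rw [Real.norm_eq_abs, abs_sub_comm]
    exact hIx n
  have hzero : ∀ n, ∫ y, conj (w ((I n).center - 1 / 2 + (I n).length * y)) * w y = 0 := by
    intro n
    have hl := (I n).length_pos
    have h := hw.integral_conj_mul ⟨0, 0⟩ (I n)
    rw [if_neg (by
      intro h
      have := congrArg DyadicInterval.scale h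
      rw [hI] at this
      simp at this
      omega)] at h
    have e : ∀ x, conj (wavelet w ⟨0, 0⟩ x) * wavelet w (I n) x =
        (((Real.sqrt (I n).length)⁻¹ : ℝ) : ℂ) * (fun y => conj (w ((I n).center - 1 / 2 + (I n).length * y)) * w y)
          ((x - (I n).center) / (I n).length) := by
      intro x
      have : x - (1 / 2 : ℝ) = (I n).center - 1 / 2 + (I n).length * ((x - (I n).center) / (I n).length) := by
        field_simp
        ring
      simp only [wavelet, DyadicInterval.length, DyadicInterval.center]
      simp only [DyadicInterval.length, DyadicInterval.center] at this
      simp only [zpow_zero, Real.sqrt_one, inv_one, Complex.ofReal_one, one_mul, mul_one, div_one,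
        Int.cast_zero, zero_add, ← this]
      ring
    simp_rw [e] at h
    rw [integral_const_mul, integral_sub_right_eq_self (fun x => (fun y => conj (w ((I n).center - 1 / 2 + (I n).length * y)) * w y)
          (x / (I n).length)) (I n).center,
      Measure.integral_comp_div (fun y => conj (w ((I n).center - 1 / 2 + (I n).length * y)) * w y)] at h
    simp only [mul_eq_zero, smul_eq_zero, abs_eq_zero, Complex.ofReal_eq_zero, inv_eq_zero, hl.ne',
      (Real.sqrt_pos.2 hl).ne', false_or] at h
    exact h
  -- In the limit the orthogonality relation reads `conj (w x0) * ∫ w = 0`.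
  have hlim : Tendsto (fun n => ∫ y, conj (w ((I n).center - 1 / 2 + (I n).length * y)) * w y) atTop
      (𝓝 (∫ y, conj (w x0) * w y)) := by
    obtain ⟨C, hC0, hC, -⟩ := exists_decay w
    refine tendsto_integral_of_dominated_convergence (fun y => C * ‖w y‖) (fun n => ?_)
      (w.integrable.norm.const_mul C) (fun n => ae_of_all _ fun y => ?_) (ae_of_all _ fun y => ?_)
    · have := w.continuous
      exact Continuous.aestronglyMeasurable (by fun_prop)
    · rw [norm_mul, RCLike.norm_conj]
      gcongr
      refine (hC _).trans (mul_le_of_le_one_right hC0.le (inv_le_one_of_one_le₀ (one_le_pow₀ ?_)))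
      linarith [abs_nonneg ((I n).center - 1 / 2 + (I n).length * y)]
    · refine Tendsto.mul_const _ ?_
      have hc : Continuous fun z => conj (w z) := Complex.continuous_conj.comp w.continuous
      refine (hc.tendsto x0).comp ?_
      have := (hcen.sub_const (1 / 2)).add (hlen0.mul_const y)
      simpa using this
  simp_rw [hzero] at hlim
  have := tendsto_nhds_unique tendsto_const_nhds hlim
  rw [integral_const_mul] at this
  rcases mul_eq_zero.1 this.symm with h | h
  · exact hx0 (by simpa using h)
  · exact hne h

lemma integrable_wavelet (w : 𝓢(ℝ, ℂ)) (I : DyadicInterval) : Integrable (wavelet w I) := by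
  obtain ⟨f, hf⟩ := exists_schwartz_eq_wavelet w I
  rw [← funext hf]
  exact f.integrable

lemma IsWaveletBasis.integral_wavelet {w : 𝓢(ℝ, ℂ)} (hw : IsWaveletBasis w) (I : DyadicInterval) :
    ∫ x, wavelet w I x = 0 := by
  simp only [wavelet]
  rw [integral_const_mul, integral_sub_right_eq_self (fun x => w (x / I.length)) I.center,
    Measure.integral_comp_div (fun x => w x), hw.integral_eq_zero, smul_zero, mul_zero]

/-! ### Summation over dyadic intervals -/

/-- Shifting by `⌊θ⌋` compares every series with one that does not depend on `θ`; the offset `1 / 2`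
keeps its denominators away from zero. -/
lemma exists_sum_inv_sq_bound : ∃ C : ℝ, 0 < C ∧ ∀ θ : ℝ,
    Summable (fun k : ℤ => ((1 + |θ - k|) ^ 2)⁻¹) ∧ ∑' k : ℤ, ((1 + |θ - k|) ^ 2)⁻¹ ≤ C := by
  have hs : Summable fun j : ℤ => 4 * (1 / |(j : ℝ) + 1 / 2| ^ (2 : ℝ)) :=
    ((Real.summable_one_div_int_add_rpow (1 / 2) 2).2 (by norm_num)).mul_left 4
  have key : ∀ (θ : ℝ) (k : ℤ), ((1 + |θ - k|) ^ 2)⁻¹ ≤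
      4 * (1 / |((k - ⌊θ⌋ : ℤ) : ℝ) + 1 / 2| ^ (2 : ℝ)) := by
    intro θ k
    have h1 := Int.floor_le θ
    have h2 := Int.lt_floor_add_one θ
    have hpos : 0 < |((k - ⌊θ⌋ : ℤ) : ℝ) + 1 / 2| := by
      rw [abs_pos]
      intro h
      have : (2 * (k - ⌊θ⌋) + 1 : ℤ) = 0 := by
        have : ((2 * (k - ⌊θ⌋) + 1 : ℤ) : ℝ) = 0 := by push_cast at h ⊢; linarith
        exact_mod_cast this
      omega
    have hle : |((k - ⌊θ⌋ : ℤ) : ℝ) + 1 / 2| ≤ 2 * (1 + |θ - k|) := by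
      push_cast
      have h3 := le_abs_self (θ - k)
      have h4 := neg_abs_le (θ - k)
      have h5 := abs_nonneg (θ - k)
      rw [abs_le]
      constructor <;> linarith
    rw [Real.rpow_two, one_div]
    calc ((1 + |θ - k|) ^ 2)⁻¹ = 4 * ((2 * (1 + |θ - k|)) ^ 2)⁻¹ := by rw [mul_pow, mul_inv]; ring
      _ ≤ _ := by gcongr
  refine ⟨(∑' j : ℤ, 4 * (1 / |(j : ℝ) + 1 / 2| ^ (2 : ℝ))) + 1, ?_, fun θ => ?_⟩
  · have : 0 ≤ ∑' j : ℤ, 4 * (1 / |(j : ℝ) + 1 / 2| ^ (2 : ℝ)) := tsum_nonneg fun j => by positivity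
    linarith
  · have hs' := (Equiv.subRight ⌊θ⌋).summable_iff.2 hs
    have hS : Summable (fun k : ℤ => ((1 + |θ - k|) ^ 2)⁻¹) :=
      Summable.of_nonneg_of_le (fun _ => by positivity) (key θ) hs'
    refine ⟨hS, (hS.tsum_le_tsum (key θ) hs').trans ?_⟩
    rw [← (Equiv.subRight ⌊θ⌋).tsum_eq (fun j : ℤ => 4 * (1 / |(j : ℝ) + 1 / 2| ^ (2 : ℝ)))]
    simp

/-- Dyadic intervals as pairs of integers. -/
def DyadicInterval.equivProd : ℤ × ℤ ≃ DyadicInterval where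
  toFun p := ⟨p.1, p.2⟩
  invFun I := (I.scale, I.pos)
  left_inv _ := rfl
  right_inv _ := rfl

/-- The weight `r ^ |n - N| / (1 + t) ^ 2`, where `2 ^ n = |I|` and `t` is the relative distance. -/
noncomputable def dyadicWeight (r : ℝ) (N : ℤ) (a : ℝ) (I : DyadicInterval) : ℝ :=
  r ^ (I.scale - N).natAbs * ((1 + I.relDist a) ^ 2)⁻¹

lemma summable_pow_natAbs {r : ℝ} (hr0 : 0 ≤ r) (hr1 : r < 1) :
    Summable fun n : ℤ => r ^ n.natAbs := by
  have := summable_geometric_of_lt_one hr0 hr1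
  apply Summable.of_nat_of_neg <;> simpa using this

lemma DyadicInterval.relDist_mk (a : ℝ) (n k : ℤ) :
    (DyadicInterval.mk n k).relDist a = |a / (2 : ℝ) ^ n - 1 / 2 - k| := by
  have hl : (2 : ℝ) ^ n ≠ 0 := zpow_ne_zero _ (by norm_num)
  rw [DyadicInterval.relDist]
  congr 1
  simp only [DyadicInterval.center, DyadicInterval.length]
  field_simp
  ring

/-- At scale `n` the centres, divided by `2 ^ n`, form a translate of `ℤ`, so the inverse squares
sum to at most a constant independent of `n` and `a`. The geometric factor then sums over the
scales. Uniformity in `N` and `a` is what keeps the final constants dependent on `w` only. -/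
lemma exists_dyadicWeight_bound {r : ℝ} (hr0 : 0 ≤ r) (hr1 : r < 1) : ∃ C : ℝ, 0 < C ∧
    ∀ (N : ℤ) (a : ℝ), Summable (dyadicWeight r N a) ∧ ∑' I, dyadicWeight r N a I ≤ C := by
  obtain ⟨C0, hC0, h0⟩ := exists_sum_inv_sq_bound
  have hr := summable_pow_natAbs hr0 hr1
  have htn : 0 ≤ ∑' n : ℤ, r ^ n.natAbs := tsum_nonneg fun _ => pow_nonneg hr0 _
  refine ⟨(∑' n : ℤ, r ^ n.natAbs) * C0 + 1, by positivity, fun N a => ?_⟩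
  have hg : ∀ n k : ℤ, dyadicWeight r N a (DyadicInterval.equivProd (n, k)) =
      r ^ (n - N).natAbs * ((1 + |a / (2 : ℝ) ^ n - 1 / 2 - k|) ^ 2)⁻¹ := by
    intro n k
    rw [← DyadicInterval.relDist_mk]
    rfl
  have hg0 : ∀ I, 0 ≤ dyadicWeight r N a I := fun I =>
    mul_nonneg (pow_nonneg hr0 _) (by positivity)
  have hsN : Summable fun n : ℤ => r ^ (n - N).natAbs * C0 :=
    ((Equiv.subRight N).summable_iff.2 hr).mul_right C0
  have hfib : ∀ n : ℤ, Summable fun k : ℤ => dyadicWeight r N a (DyadicInterval.equivProd (n, k)) := by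
    intro n
    simp_rw [hg]
    exact (h0 _).1.mul_left _
  have hle : ∀ n : ℤ, ∑' k : ℤ, dyadicWeight r N a (DyadicInterval.equivProd (n, k)) ≤
      r ^ (n - N).natAbs * C0 := by
    intro n
    simp_rw [hg]
    rw [tsum_mul_left]
    exact mul_le_mul_of_nonneg_left (h0 _).2 (pow_nonneg hr0 _)
  have hout : Summable fun n : ℤ => ∑' k : ℤ, dyadicWeight r N a (DyadicInterval.equivProd (n, k)) :=
    Summable.of_nonneg_of_le (fun n => tsum_nonneg fun k => hg0 _) hle hsN
  have hgs : Summable fun p => dyadicWeight r N a (DyadicInterval.equivProd p) :=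
    (summable_prod_of_nonneg fun p => hg0 _).2 ⟨hfib, hout⟩
  refine ⟨DyadicInterval.equivProd.summable_iff.1 hgs, ?_⟩
  rw [← DyadicInterval.equivProd.tsum_eq, hgs.tsum_prod' hfib]
  refine (hout.tsum_le_tsum hle hsN).trans ?_
  rw [tsum_mul_right]
  have := (Equiv.subRight N).tsum_eq (fun n : ℤ => r ^ n.natAbs)
  simp only [Equiv.subRight_apply] at this
  rw [this]
  linarith

lemma exists_sum_dyadicWeight_le {r : ℝ} (hr0 : 0 ≤ r) (hr1 : r < 1) : ∃ C : ℝ, 0 < C ∧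
    ∀ (N : ℤ) (a : ℝ) (S : Finset DyadicInterval), ∑ I ∈ S, dyadicWeight r N a I ≤ C := by
  obtain ⟨C, hC, h⟩ := exists_dyadicWeight_bound hr0 hr1
  exact ⟨C, hC, fun N a S => ((h N a).1.sum_le_tsum S fun I _ =>
    mul_nonneg (pow_nonneg hr0 _) (by positivity)).trans (h N a).2⟩

/-! ### Wavelet coefficients of vector valued functions -/

section Parseval

variable {K : Type u} [NormedAddCommGroup K] [InnerProductSpace ℂ K]

/-- The wavelet coefficient `∫ f(x) conj (w_I(x)) dx` of a vector valued function. -/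
noncomputable def vcoeff (w : 𝓢(ℝ, ℂ)) (f : ℝ → K) (I : DyadicInterval) : K :=
  ∫ x, conj (wavelet w I x) • f x

lemma memLp_wavelet_smul_const (w : 𝓢(ℝ, ℂ)) (I : DyadicInterval) (v : K) :
    MemLp (fun x => wavelet w I x • v) 2 (volume : Measure ℝ) := by
  refine MemLp.of_le_mul (c := ‖v‖) (memLp_wavelet w I)
    ((continuous_wavelet w I).smul continuous_const).aestronglyMeasurable (ae_of_all _ fun x => ?_)
  rw [norm_smul, mul_comm]

lemma inner_toLp_wavelet_smul [CompleteSpace K] (w : 𝓢(ℝ, ℂ)) (I : DyadicInterval) (v : K) {f : ℝ → K}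
    (hf : MemLp f 2 (volume : Measure ℝ)) :
    inner ℂ ((memLp_wavelet_smul_const w I v).toLp _) (hf.toLp f) = inner ℂ v (vcoeff w f I) := by
  have hi : Integrable (fun x => conj (wavelet w I x) • f x) := by
    have h1 : MemLp (fun x => conj (wavelet w I x)) 2 (volume : Measure ℝ) := (memLp_wavelet w I).star
    have := hf.smul (r := 1) h1
    exact memLp_one_iff_integrable.1 this
  rw [vcoeff, ← integral_inner hi, L2.inner_def]
  refine integral_congr_ae ?_
  filter_upwards [(memLp_wavelet_smul_const w I v).coeFn_toLp, hf.coeFn_toLp] with x h1 h2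
  rw [h1, h2, inner_smul_left, inner_smul_right]

/-- `v ↦ w_I v` as an isometry into `L²(ℝ; K)`. -/
noncomputable def waveletIsometry {w : 𝓢(ℝ, ℂ)} (hw : IsWaveletBasis w) (I : DyadicInterval) :
    K →ₗᵢ[ℂ] Lp K 2 (volume : Measure ℝ) where
  toFun v := (memLp_wavelet_smul_const w I v).toLp _
  map_add' u v := by
    rw [← MemLp.toLp_add]
    congr 1
    funext x
    simp
  map_smul' c v := by
    rw [RingHom.id_apply, ← MemLp.toLp_const_smul]
    congr 1
    funext x
    exact smul_comm _ _ _
  norm_map' v := by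
    change ‖(memLp_wavelet_smul_const w I v).toLp _‖ = _
    have h1 : ‖waveletL2 w I‖ = 1 := hw.1.1 I
    rw [waveletL2, Lp.norm_toLp] at h1
    have h2 : eLpNorm (fun x => wavelet w I x • v) 2 (volume : Measure ℝ) =
        eLpNorm (fun x => (‖v‖ : ℂ) • wavelet w I x) 2 (volume : Measure ℝ) := by
      refine eLpNorm_congr_norm_ae (ae_of_all _ fun x => ?_)
      simp [norm_smul, mul_comm]
    rw [Lp.norm_toLp, h2]
    have h3 := eLpNorm_const_smul (‖v‖ : ℂ) (wavelet w I) 2 (volume : Measure ℝ)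
    have h4 : (fun x => (‖v‖ : ℂ) • wavelet w I x) = (‖v‖ : ℂ) • wavelet w I := rfl
    rw [h4, h3, ENNReal.toReal_mul, h1]
    simp

variable [CompleteSpace K]

/-- Completeness passes from scalars to `K` by testing: if `g` is orthogonal to all `w_I v`, then
the scalar function `⟨v, g⟩` is orthogonal to every `w_I` and vanishes almost everywhere. The null
set depends on `v`, so `g = 0` is concluded through set integrals, which needs no separability of
`K`. -/
lemma IsWaveletBasis.isHilbertSum {w : 𝓢(ℝ, ℂ)} (hw : IsWaveletBasis w) :
    IsHilbertSum ℂ (fun _ : DyadicInterval => K) (waveletIsometry hw) := by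
  classical
  refine IsHilbertSum.mk ?_ ?_
  · intro I J hIJ u v
    change inner ℂ ((memLp_wavelet_smul_const w I u).toLp _) ((memLp_wavelet_smul_const w J v).toLp _) = 0
    rw [inner_toLp_wavelet_smul, vcoeff]
    simp_rw [smul_smul]
    rw [integral_smul_const, hw.integral_conj_mul, if_neg hIJ, zero_smul, inner_zero_right]
  · rw [top_le_iff, Submodule.topologicalClosure_eq_top_iff, eq_bot_iff]
    intro g hg
    have hg0 : ∀ I (v : K), inner ℂ v (vcoeff w g I) = 0 := by
      intro I v
      rw [← inner_toLp_wavelet_smul w I v (Lp.memLp g), Lp.toLp_coeFn]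
      exact (Submodule.mem_orthogonal _ _).1 hg _
        (Submodule.mem_iSup_of_mem I (LinearMap.mem_range_self _ v))
    have hv : ∀ v : K, (fun x => inner ℂ v (g x)) =ᵐ[volume] 0 := by
      intro v
      have hm : MemLp (fun x => inner ℂ v (g x)) 2 (volume : Measure ℝ) := (Lp.memLp g).const_inner v
      have hz : hm.toLp _ = 0 := by
        have hbot := (Submodule.topologicalClosure_eq_top_iff).1 hw.2
        rw [← Submodule.mem_bot ℂ, ← hbot, Submodule.mem_orthogonal]
        intro u hu
        refine Submodule.span_induction (p := fun u _ => inner ℂ u (hm.toLp _) = 0) ?_ ?_ ?_ ?_ hu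
        · rintro _ ⟨I, rfl⟩
          rw [L2.inner_def, ← hg0 I v, vcoeff, ← integral_inner]
          · refine integral_congr_ae ?_
            filter_upwards [(memLp_wavelet w I).coeFn_toLp, hm.coeFn_toLp] with x h1 h2
            rw [waveletL2, h1, h2, inner_smul_right, RCLike.inner_apply, mul_comm]
          · have h1 : MemLp (fun x => conj (wavelet w I x)) 2 (volume : Measure ℝ) :=
              (memLp_wavelet w I).star
            exact memLp_one_iff_integrable.1 ((Lp.memLp g).smul (r := 1) h1)
        · exact inner_zero_left _
        · intro x y _ _ hx hy
          rw [inner_add_left, hx, hy, add_zero]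
        · intro c x _ hx
          rw [inner_smul_left, hx, mul_zero]
      have := hm.coeFn_toLp
      rw [hz] at this
      exact this.symm.trans (Lp.coeFn_zero _ _ _)
    rw [Submodule.mem_bot]
    apply Lp.ext
    refine (Lp.ae_eq_zero_of_forall_setIntegral_eq_zero g (by norm_num) (by norm_num)
      (fun s hs hμ => ?_) (fun s hs hμ => ?_)).trans (Lp.coeFn_zero _ _ _).symm
    · exact integrableOn_Lp_of_measure_ne_top g (by norm_num) hμ.ne
    · refine ext_inner_left ℂ fun v => ?_
      rw [← integral_inner (integrableOn_Lp_of_measure_ne_top g (by norm_num) hμ.ne), inner_zero_right]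
      exact integral_eq_zero_of_ae (ae_restrict_of_ae (hv v))

/-- Parseval's identity for vector valued functions. -/
lemma IsWaveletBasis.hasSum_inner_vcoeff {w : 𝓢(ℝ, ℂ)} (hw : IsWaveletBasis w) {f g : ℝ → K}
    (hf : MemLp f 2 (volume : Measure ℝ)) (hg : MemLp g 2 (volume : Measure ℝ)) :
    HasSum (fun I => inner ℂ (vcoeff w f I) (vcoeff w g I)) (∫ x, inner ℂ (f x) (g x)) := by
  classical
  set e := (hw.isHilbertSum (K := K)).linearIsometryEquiv with he
  have hc : ∀ {f : ℝ → K} (hf : MemLp f 2 (volume : Measure ℝ)) I, (e (hf.toLp f)) I = vcoeff w f I := by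
    intro f hf I
    refine ext_inner_left ℂ fun v => ?_
    refine (lp.inner_single_left (𝕜 := ℂ) I v (e (hf.toLp f))).symm.trans ?_
    rw [← inner_toLp_wavelet_smul w I v hf]
    change _ = inner ℂ (waveletIsometry hw I v) _
    rw [← (hw.isHilbertSum (K := K)).linearIsometryEquiv_symm_apply_single, ← he,
      ← e.inner_map_map, LinearIsometryEquiv.apply_symm_apply]
  have h := lp.hasSum_inner (𝕜 := ℂ) (e (hf.toLp f)) (e (hg.toLp g))
  rw [e.inner_map_map, L2.inner_def] at h
  have h' : HasSum (fun I => inner ℂ (vcoeff w f I) (vcoeff w g I))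
      (∫ x, inner ℂ (hf.toLp f x) (hg.toLp g x)) := by
    refine h.congr_fun fun I => ?_
    exact congrArg₂ (inner ℂ) (hc hf I).symm (hc hg I).symm
  convert h' using 1
  refine integral_congr_ae ?_
  filter_upwards [hf.coeFn_toLp, hg.coeFn_toLp] with x h1 h2
  rw [h1, h2]

lemma IsWaveletBasis.hasSum_norm_vcoeff_sq {w : 𝓢(ℝ, ℂ)} (hw : IsWaveletBasis w) {f : ℝ → K}
    (hf : MemLp f 2 (volume : Measure ℝ)) :
    HasSum (fun I => ‖vcoeff w f I‖ ^ 2) (∫ x, ‖f x‖ ^ 2) := by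
  have h := hw.hasSum_inner_vcoeff hf hf
  simp_rw [inner_self_eq_norm_sq_to_K] at h
  have h2 := Complex.hasSum_re h
  convert h2 using 1
  · funext I
    norm_cast
  · have : (fun x => (‖f x‖ : ℂ) ^ 2) = fun x => ((‖f x‖ ^ 2 : ℝ) : ℂ) := by
      funext x
      push_cast
      rfl
    change _ = (∫ x, (‖f x‖ : ℂ) ^ 2).re
    rw [this, integral_complex_ofReal, Complex.ofReal_re]

end Parseval

section Weighted

variable {K : Type u} [NormedAddCommGroup K]

/-! ### Functions that are square integrable against `dx / (1 + x²)` -/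

/-- `f` is square integrable against `dx / (1 + x²)`. -/
structure WeightedL2 (f : ℝ → K) : Prop where
  aesm : AEStronglyMeasurable f volume
  int : Integrable (fun x => ‖f x‖ ^ 2 * (1 + x ^ 2)⁻¹)

lemma WeightedL2.indicator {f : ℝ → K} (hf : WeightedL2 f) {s : Set ℝ} (hs : MeasurableSet s) :
    WeightedL2 (s.indicator f) := by
  refine ⟨hf.aesm.indicator hs, (hf.int.indicator hs).congr (ae_of_all _ fun x => ?_)⟩
  by_cases h : x ∈ s <;> simp [h]

lemma WeightedL2.memLp_indicator {f : ℝ → K} (hf : WeightedL2 f) {s : Set ℝ} (hs : MeasurableSet s)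
    {R : ℝ} (hR : ∀ x ∈ s, |x| ≤ R) : MemLp (s.indicator f) 2 (volume : Measure ℝ) := by
  rw [memLp_two_iff_integrable_sq_norm (hf.aesm.indicator hs)]
  refine Integrable.mono' (hf.int.const_mul (1 + R ^ 2)) ?_ (ae_of_all _ fun x => ?_)
  · exact ((hf.aesm.indicator hs).norm.pow 2)
  · by_cases h : x ∈ s
    · rw [Set.indicator_of_mem h, Real.norm_of_nonneg (by positivity)]
      have h1 : x ^ 2 ≤ R ^ 2 := sq_le_sq' (by linarith [neg_abs_le x, hR x h]) ((le_abs_self x).trans (hR x h))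
      have : 1 ≤ (1 + R ^ 2) * (1 + x ^ 2)⁻¹ := by
        rw [← div_eq_mul_inv, one_le_div (by positivity)]
        linarith
      nlinarith [sq_nonneg ‖f x‖]
    · rw [Set.indicator_of_notMem h]
      simp only [norm_zero]
      rw [zero_pow two_ne_zero, norm_zero]
      positivity

lemma WeightedL2.memLp_Ioc {f : ℝ → K} (hf : WeightedL2 f) (a b : ℝ) :
    MemLp ((Set.Ioc a b).indicator f) 2 (volume : Measure ℝ) := by
  refine hf.memLp_indicator measurableSet_Ioc (R := |a| + |b|) fun x hx => ?_
  rw [abs_le]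
  constructor <;> linarith [hx.1, hx.2, neg_abs_le a, le_abs_self b, abs_nonneg a, abs_nonneg b]

lemma WeightedL2.memLp_restrict {f : ℝ → K} (hf : WeightedL2 f) (a b : ℝ) :
    MemLp f 2 (volume.restrict (Set.Ioc a b)) :=
  (memLp_indicator_iff_restrict measurableSet_Ioc).1 (hf.memLp_Ioc a b)

lemma WeightedL2.integrableOn {f : ℝ → K} (hf : WeightedL2 f) (a b : ℝ) :
    IntegrableOn f (Set.Ioc a b) :=
  (hf.memLp_restrict a b).integrable (by norm_num)

lemma WeightedL2.sub_const {f : ℝ → K} (hf : WeightedL2 f) (v : K) : WeightedL2 fun x => f x - v := by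
  refine ⟨hf.aesm.sub aestronglyMeasurable_const, ?_⟩
  refine Integrable.mono' ((hf.int.const_mul 2).add (integrable_inv_one_add_sq.const_mul (2 * ‖v‖ ^ 2)))
    ?_ (ae_of_all _ fun x => ?_)
  · exact ((hf.aesm.sub aestronglyMeasurable_const).norm.pow 2).mul
      (Measurable.aestronglyMeasurable (by fun_prop))
  · rw [Real.norm_of_nonneg (by positivity)]
    have h := norm_sub_le (f x) v
    have h2 : ‖f x - v‖ ^ 2 ≤ 2 * ‖f x‖ ^ 2 + 2 * ‖v‖ ^ 2 := by
      nlinarith [sq_nonneg (‖f x‖ - ‖v‖), norm_nonneg (f x - v)]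
    calc ‖f x - v‖ ^ 2 * (1 + x ^ 2)⁻¹ ≤ (2 * ‖f x‖ ^ 2 + 2 * ‖v‖ ^ 2) * (1 + x ^ 2)⁻¹ := by gcongr
      _ = _ := by simp only [Pi.add_apply]; ring

lemma integral_comp_wavelet_scale (I : DyadicInterval) :
    Integrable (fun x => I.length⁻¹ * (1 + ((x - I.center) / I.length) ^ 2)⁻¹) ∧
    ∫ x, I.length⁻¹ * (1 + ((x - I.center) / I.length) ^ 2)⁻¹ = Real.pi := by
  have hl := I.length_pos
  constructor
  · refine Integrable.const_mul ?_ _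
    have h1 := integrable_inv_one_add_sq.comp_div hl.ne'
    exact h1.comp_sub_right I.center
  · rw [integral_const_mul, integral_sub_right_eq_self (fun x => (1 + (x / I.length) ^ 2)⁻¹) I.center,
      Measure.integral_comp_div (fun x : ℝ => (1 + x ^ 2)⁻¹), integral_univ_inv_one_add_sq,
      abs_of_pos hl, smul_eq_mul, ← mul_assoc, inv_mul_cancel₀ hl.ne', one_mul]

/-- A weighted Cauchy–Schwarz inequality. -/
lemma WeightedL2.integral_wavelet_mul_le (w : 𝓢(ℝ, ℂ)) (I : DyadicInterval) {f : ℝ → K}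
    (hf : WeightedL2 f) {G : ℝ} (hG : 0 < G)
    (h : ∀ x, f x ≠ 0 → (1 + x ^ 2) * ‖wavelet w I x‖ ^ 2 ≤
      G ^ 2 * (I.length⁻¹ * (1 + ((x - I.center) / I.length) ^ 2)⁻¹)) :
    Integrable (fun x => ‖wavelet w I x‖ * ‖f x‖) ∧
    ∫ x, ‖wavelet w I x‖ * ‖f x‖ ≤ G * (Real.pi + ∫ x, ‖f x‖ ^ 2 * (1 + x ^ 2)⁻¹) := by
  obtain ⟨hi, hpi⟩ := integral_comp_wavelet_scale I
  have hb : ∀ x, ‖wavelet w I x‖ * ‖f x‖ ≤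
      G * (I.length⁻¹ * (1 + ((x - I.center) / I.length) ^ 2)⁻¹) +
        G * (‖f x‖ ^ 2 * (1 + x ^ 2)⁻¹) := by
    intro x
    have hl := I.length_pos
    by_cases hx : f x = 0
    · rw [hx, norm_zero, mul_zero]
      positivity
    have h1 := h x hx
    set W := ‖wavelet w I x‖
    set p : ℝ := 1 + x ^ 2 with hp
    have hp0 : 0 < p := by positivity
    set q := I.length⁻¹ * (1 + ((x - I.center) / I.length) ^ 2)⁻¹
    -- The arithmetic-geometric mean inequality with parameter `G`. By the hypothesis, both terms
    -- are then at most `G` times a function of known integral, the first being the rescaled kernel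
    -- of integral `π`.
    have h2 : W * ‖f x‖ ≤ G⁻¹ * (p * W ^ 2) + G * (‖f x‖ ^ 2 * p⁻¹) := by
      have e : G⁻¹ * (p * W ^ 2) + G * (‖f x‖ ^ 2 * p⁻¹) - 2 * (W * ‖f x‖) =
          G⁻¹ * p * (W - G * p⁻¹ * ‖f x‖) ^ 2 := by
        field_simp
        ring
      have : 0 ≤ G⁻¹ * p * (W - G * p⁻¹ * ‖f x‖) ^ 2 := by positivity
      have : 0 ≤ W * ‖f x‖ := by positivity
      linarith
    have h3 : G⁻¹ * (p * W ^ 2) ≤ G⁻¹ * (G ^ 2 * q) := by gcongr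
    have h4 : G⁻¹ * (G ^ 2 * q) = G * q := by field_simp
    linarith
  have hint : Integrable (fun x => G * (I.length⁻¹ * (1 + ((x - I.center) / I.length) ^ 2)⁻¹) +
        G * (‖f x‖ ^ 2 * (1 + x ^ 2)⁻¹)) := (hi.const_mul G).add (hf.int.const_mul G)
  have hI : Integrable (fun x => ‖wavelet w I x‖ * ‖f x‖) := by
    refine hint.mono' ((continuous_wavelet w I).norm.aestronglyMeasurable.mul hf.aesm.norm)
      (ae_of_all _ fun x => ?_)
    rw [Real.norm_of_nonneg (by positivity)]
    exact hb x
  refine ⟨hI, (integral_mono hI hint hb).trans ?_⟩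
  rw [integral_add (hi.const_mul G) (hf.int.const_mul G), integral_const_mul G, integral_const_mul G,
    hpi, mul_add]

lemma one_add_sq_le (a x : ℝ) : 1 + x ^ 2 ≤ 2 * (1 + a ^ 2) * (1 + |x - a|) ^ 2 := by
  have h : x ^ 2 ≤ 2 * a ^ 2 + 2 * |x - a| ^ 2 := by
    rw [sq_abs]
    nlinarith [sq_nonneg (x - 2 * a)]
  nlinarith [abs_nonneg (x - a), sq_nonneg a, mul_nonneg (sq_nonneg a) (abs_nonneg (x - a)),
    mul_nonneg (sq_nonneg a) (sq_nonneg |x - a|)]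

lemma WeightedL2.integrable_wavelet_mul {w : 𝓢(ℝ, ℂ)} (I : DyadicInterval) {f : ℝ → K}
    (hf : WeightedL2 f) : Integrable (fun x => ‖wavelet w I x‖ * ‖f x‖) := by
  obtain ⟨C, hC0, hC, -⟩ := exists_decay w
  have hl := I.length_pos
  set ℓ := I.length with hℓ
  refine (hf.integral_wavelet_mul_le w I (G := Real.sqrt (2 * (1 + I.center ^ 2) * (1 + ℓ) ^ 2 * C ^ 2))
    (by positivity) fun x _ => ?_).1
  rw [Real.sq_sqrt (by positivity)]
  have h1 := norm_wavelet_le hC I x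
  have h2 := one_add_sq_le I.center x
  set t := I.relDist x with ht
  have ht0 : 0 ≤ t := I.relDist_nonneg x
  have h3 : |x - I.center| = ℓ * t := by
    rw [ht, I.relDist_eq, mul_div_cancel₀ _ hl.ne']
  have h4 : ((x - I.center) / I.length) ^ 2 = t ^ 2 := by rw [ht, DyadicInterval.relDist, sq_abs]
  rw [h3] at h2
  rw [h4]
  have h5 : (1 + ℓ * t) ^ 2 ≤ (1 + ℓ) ^ 2 * (1 + t) ^ 2 := by
    rw [← mul_pow]
    gcongr
    nlinarith
  have hs : ((Real.sqrt ℓ)⁻¹) ^ 2 = ℓ⁻¹ := by rw [inv_pow, Real.sq_sqrt hl.le]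
  have h6 : (1 + t) ^ 2 * (((1 + t) ^ 6)⁻¹) ^ 2 ≤ (1 + t ^ 2)⁻¹ := by
    have : (1 + t) ^ 2 * (((1 + t) ^ 6)⁻¹) ^ 2 = ((1 + t) ^ 10)⁻¹ := by field_simp
    rw [this]
    gcongr
    calc 1 + t ^ 2 ≤ (1 + t) ^ 2 := by nlinarith
      _ ≤ (1 + t) ^ 10 := pow_le_pow_right₀ (by linarith) (by norm_num)
  calc (1 + x ^ 2) * ‖wavelet w I x‖ ^ 2
      ≤ (2 * (1 + I.center ^ 2) * ((1 + ℓ) ^ 2 * (1 + t) ^ 2)) *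
        (C * (Real.sqrt ℓ)⁻¹ * ((1 + t) ^ 6)⁻¹) ^ 2 := by
        gcongr
        exact h2.trans (by gcongr)
    _ = 2 * (1 + I.center ^ 2) * (1 + ℓ) ^ 2 * C ^ 2 * (((Real.sqrt ℓ)⁻¹) ^ 2 *
        ((1 + t) ^ 2 * (((1 + t) ^ 6)⁻¹) ^ 2)) := by ring
    _ ≤ _ := by
        rw [hs]
        gcongr

variable [InnerProductSpace ℂ K]

lemma WeightedL2.integrable_conj_wavelet_smul {w : 𝓢(ℝ, ℂ)} (I : DyadicInterval) {f : ℝ → K}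
    (hf : WeightedL2 f) : Integrable (fun x => conj (wavelet w I x) • f x) := by
  refine (hf.integrable_wavelet_mul (w := w) I).mono' ?_ (ae_of_all _ fun x => ?_)
  · exact (Complex.continuous_conj.comp (continuous_wavelet w I)).aestronglyMeasurable.smul hf.aesm
  · rw [norm_smul, RCLike.norm_conj]

lemma vcoeff_add {w : 𝓢(ℝ, ℂ)} (I : DyadicInterval) {f g : ℝ → K}
    (hf : WeightedL2 f) (hg : WeightedL2 g) :
    vcoeff w (fun x => f x + g x) I = vcoeff w f I + vcoeff w g I := by
  simp only [vcoeff, smul_add]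
  exact integral_add (hf.integrable_conj_wavelet_smul I) (hg.integrable_conj_wavelet_smul I)

lemma vcoeff_eq_add_indicator {w : 𝓢(ℝ, ℂ)} (I : DyadicInterval) {f : ℝ → K}
    (hf : WeightedL2 f) {s : Set ℝ} (hs : MeasurableSet s) :
    vcoeff w f I = vcoeff w (s.indicator f) I + vcoeff w (sᶜ.indicator f) I := by
  rw [← vcoeff_add I (hf.indicator hs) (hf.indicator hs.compl)]
  congr 1
  funext x
  exact (Set.indicator_self_add_compl_apply s f x).symm

variable [CompleteSpace K]

lemma IsWaveletBasis.vcoeff_sub_const {w : 𝓢(ℝ, ℂ)} (hw : IsWaveletBasis w) (I : DyadicInterval)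
    {f : ℝ → K} (hf : WeightedL2 f) (v : K) :
    vcoeff w (fun x => f x - v) I = vcoeff w f I := by
  have h1 : Integrable (fun x => conj (wavelet w I x) • v) :=
    Integrable.smul_const ((LinearIsometryEquiv.integrable_comp_iff Complex.conjLIE).2
      (integrable_wavelet w I)) v
  simp only [vcoeff, smul_sub]
  rw [integral_sub (hf.integrable_conj_wavelet_smul I) h1, integral_smul_const, integral_conj,
    hw.integral_wavelet, map_zero, zero_smul, sub_zero]

/-! ### Means -/

/-- The mean of `f` over `(a, b]`. -/
noncomputable def avg (f : ℝ → K) (a b : ℝ) : K := (b - a)⁻¹ • ∫ x in Set.Ioc a b, f x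

omit [InnerProductSpace ℂ K] [CompleteSpace K] in
lemma setIntegral_norm_le_sqrt {h : ℝ → K} {a b : ℝ} (hab : a ≤ b)
    (hh : MemLp h 2 (volume.restrict (Set.Ioc a b))) :
    ∫ x in Set.Ioc a b, ‖h x‖ ≤ Real.sqrt (b - a) * Real.sqrt (∫ x in Set.Ioc a b, ‖h x‖ ^ 2) := by
  have := integral_mul_le_Lp_mul_Lq_of_nonneg (μ := volume.restrict (Set.Ioc a b)) (p := 2) (q := 2)
    (Real.HolderConjugate.two_two) (f := fun _ => (1 : ℝ)) (g := fun x => ‖h x‖)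
    (ae_of_all _ fun _ => zero_le_one) (ae_of_all _ fun _ => norm_nonneg _)
    (memLp_const _) (by simpa using hh.norm)
  simp only [one_mul, integral_const, smul_eq_mul, Real.rpow_two,
    ← Real.sqrt_eq_rpow] at this
  simpa [hab] using this

lemma norm_avg_sub_le {f : ℝ → K} {a b : ℝ} (hab : a < b) (hf : IntegrableOn f (Set.Ioc a b)) (v : K) :
    ‖avg f a b - v‖ ≤ (b - a)⁻¹ * ∫ x in Set.Ioc a b, ‖f x - v‖ := by
  have h0 : 0 < b - a := by linarith
  have hc : IntegrableOn (fun _ : ℝ => v) (Set.Ioc a b) := integrableOn_const (by simp)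
  have : avg f a b - v = (b - a)⁻¹ • ∫ x in Set.Ioc a b, (f x - v) := by
    rw [integral_sub hf hc, smul_sub, setIntegral_const, Real.volume_real_Ioc_of_le hab.le, smul_smul,
      inv_mul_cancel₀ h0.ne', one_smul, avg]
  rw [this, norm_smul, Real.norm_of_nonneg (by positivity)]
  gcongr
  exact norm_integral_le_integral_norm _

/-- The mean oscillation of `f` is at most `D`. -/
def OscBound (f : ℝ → K) (D : ℝ) : Prop :=
  ∀ a b, a < b → ∫ x in Set.Ioc a b, ‖f x - avg f a b‖ ^ 2 ≤ D ^ 2 * (b - a)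

variable {f : ℝ → K} {D : ℝ}

omit [CompleteSpace K] in
lemma OscBound.setIntegral_norm_le (h : OscBound f D) (hf : WeightedL2 f) (hD : 0 ≤ D) {a b : ℝ}
    (hab : a < b) : ∫ x in Set.Ioc a b, ‖f x - avg f a b‖ ≤ D * (b - a) := by
  have h0 : 0 < b - a := by linarith
  refine (setIntegral_norm_le_sqrt hab.le ((hf.sub_const _).memLp_restrict a b)).trans ?_
  calc Real.sqrt (b - a) * Real.sqrt (∫ x in Set.Ioc a b, ‖f x - avg f a b‖ ^ 2)
      ≤ Real.sqrt (b - a) * Real.sqrt (D ^ 2 * (b - a)) := by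
        gcongr
        exact h a b hab
    _ = D * (Real.sqrt (b - a) * Real.sqrt (b - a)) := by
        rw [Real.sqrt_mul (sq_nonneg D), Real.sqrt_sq hD]; ring
    _ = _ := by rw [Real.mul_self_sqrt h0.le]

/-- The smaller interval fills half of the larger one, so averaging over it costs a factor 2. -/
lemma OscBound.norm_avg_sub_avg_le (h : OscBound f D) (hf : WeightedL2 f) (hD : 0 ≤ D) (c : ℝ) {L : ℝ}
    (hL : 0 < L) : ‖avg f (c - L) (c + L) - avg f (c - 2 * L) (c + 2 * L)‖ ≤ 2 * D := by
  refine (norm_avg_sub_le (by linarith) (hf.integrableOn _ _) _).trans ?_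
  have h1 : ∫ x in Set.Ioc (c - L) (c + L), ‖f x - avg f (c - 2 * L) (c + 2 * L)‖ ≤
      ∫ x in Set.Ioc (c - 2 * L) (c + 2 * L), ‖f x - avg f (c - 2 * L) (c + 2 * L)‖ := by
    refine setIntegral_mono_set ((hf.sub_const _).integrableOn _ _).norm
      (ae_of_all _ fun _ => norm_nonneg _) (Set.Ioc_subset_Ioc ?_ ?_).eventuallyLE <;> linarith
  have h2 := h.setIntegral_norm_le hf hD (a := c - 2 * L) (b := c + 2 * L) (by linarith)
  calc _ ≤ (c + L - (c - L))⁻¹ * (D * (c + 2 * L - (c - 2 * L))) := by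
        have : 0 ≤ (c + L - (c - L))⁻¹ := inv_nonneg.2 (by linarith)
        gcongr
        exact h1.trans h2
    _ = 2 * D := by
        rw [show c + L - (c - L) = 2 * L by ring]
        field_simp
        ring

/-- Telescoping over `j` doublings moves the mean by at most `2 * j * D`; keeping the initial mean
on the dilate thus loses only a factor linear in `j`. -/
lemma OscBound.setIntegral_norm_sub_avg_le (h : OscBound f D) (hf : WeightedL2 f) (hD : 0 ≤ D) (c : ℝ)
    {L : ℝ} (hL : 0 < L) (j : ℕ) :
    ∫ x in Set.Ioc (c - 2 ^ j * L) (c + 2 ^ j * L), ‖f x - avg f (c - L) (c + L)‖ ≤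
      D * (2 * 2 ^ j * L) * (1 + 2 * j) := by
  have hm : ∀ j : ℕ, ‖avg f (c - 2 ^ j * L) (c + 2 ^ j * L) - avg f (c - L) (c + L)‖ ≤ 2 * j * D := by
    intro j
    induction j with
    | zero => simp
    | succ j ih =>
      have h1 := h.norm_avg_sub_avg_le hf hD c (L := 2 ^ j * L) (by positivity)
      rw [← mul_assoc, ← pow_succ'] at h1
      rw [norm_sub_rev] at h1
      refine (norm_sub_le_norm_sub_add_norm_sub _ (avg f (c - 2 ^ j * L) (c + 2 ^ j * L)) _).trans ?_
      push_cast
      linarith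
  set P := 2 ^ j * L with hP
  have hP0 : 0 < P := by positivity
  have hi := ((hf.sub_const (avg f (c - P) (c + P))).integrableOn (c - P) (c + P)).norm
  have hc : IntegrableOn (fun _ : ℝ => 2 * j * D) (Set.Ioc (c - P) (c + P)) :=
    integrableOn_const (by simp)
  calc ∫ x in Set.Ioc (c - P) (c + P), ‖f x - avg f (c - L) (c + L)‖
      ≤ ∫ x in Set.Ioc (c - P) (c + P), (‖f x - avg f (c - P) (c + P)‖ + 2 * j * D) := by
        refine integral_mono ((hf.sub_const _).integrableOn _ _).norm (hi.add hc) fun x => ?_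
        refine (norm_sub_le_norm_sub_add_norm_sub _ (avg f (c - P) (c + P)) _).trans ?_
        exact add_le_add_right (hm j) _
    _ = (∫ x in Set.Ioc (c - P) (c + P), ‖f x - avg f (c - P) (c + P)‖) + 2 * P * (2 * j * D) := by
        rw [integral_add hi hc, setIntegral_const, Real.volume_real_Ioc_of_le (by linarith), smul_eq_mul]
        ring
    _ ≤ D * (c + P - (c - P)) + 2 * P * (2 * j * D) := by
        gcongr
        exact h.setIntegral_norm_le hf hD (by linarith)
    _ = _ := by rw [hP]; ring

/-- On the `j`-th dyadic annulus the kernel is at most `(2 ^ j * L)⁻²`, whereas the integral of the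
oscillation grows like `j * 2 ^ j * L`, so the series converges. The lower integral avoids a
separate integrability proof. -/
lemma OscBound.lintegral_tail_le (h : OscBound f D) (hf : WeightedL2 f) (hD : 0 ≤ D) (c : ℝ)
    {L : ℝ} (hL : 0 < L) :
    ∫⁻ x in (Set.Ioc (c - L) (c + L))ᶜ,
      ENNReal.ofReal (((x - c) ^ 2)⁻¹ * ‖f x - avg f (c - L) (c + L)‖) ≤ ENNReal.ofReal (64 * D / L) := by
  set m := avg f (c - L) (c + L) with hm
  set q : ℕ → ℝ → ℝ≥0∞ := fun j => (Set.Ioc (c - 2 ^ (j + 1) * L) (c + 2 ^ (j + 1) * L)).indicator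
    fun x => ENNReal.ofReal (((2 ^ j * L) ^ 2)⁻¹ * ‖f x - m‖) with hq
  have haes : AEStronglyMeasurable (fun x => f x - m) volume := (hf.sub_const m).aesm
  have hpt : ∀ x ∈ (Set.Ioc (c - L) (c + L))ᶜ,
      ENNReal.ofReal (((x - c) ^ 2)⁻¹ * ‖f x - m‖) ≤ ∑' j, q j x := by
    intro x hx
    have hxL : L ≤ |x - c| := by
      by_contra! hlt
      rw [abs_lt] at hlt
      exact hx ⟨by linarith, by linarith⟩
    obtain ⟨j, hj1, hj2⟩ := exists_nat_pow_near ((one_le_div hL).2 hxL) (one_lt_two)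
    rw [le_div_iff₀ hL] at hj1
    rw [div_lt_iff₀ hL, abs_lt] at hj2
    refine le_trans ?_ (ENNReal.le_tsum j)
    rw [hq]
    simp only
    rw [Set.indicator_of_mem (show x ∈ Set.Ioc (c - 2 ^ (j + 1) * L) (c + 2 ^ (j + 1) * L) from
      ⟨by linarith, by linarith⟩)]
    refine ENNReal.ofReal_le_ofReal ?_
    rw [← sq_abs (x - c)]
    gcongr
  have hgeo : HasSum (fun j : ℕ => 16 * D / L * (3 / 4 : ℝ) ^ j) (64 * D / L) := by
    have := (hasSum_geometric_of_lt_one (r := (3 / 4 : ℝ)) (by norm_num) (by norm_num)).mul_left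
      (16 * D / L)
    rwa [show 16 * D / L * (1 - 3 / 4 : ℝ)⁻¹ = 64 * D / L by norm_num; ring] at this
  -- The linear growth is absorbed by `(3 / 2) ^ j`, which leaves the ratio `3 / 4` after division
  -- by `2 ^ j`. The case `j = 0` is separate because the induction step needs `j ≥ 1 / 2`.
  have hnum : ∀ j : ℕ, (2 * j + 3 : ℝ) ≤ 4 * (3 / 2) ^ j := by
    intro j
    rcases Nat.lt_or_ge j 1 with hj | hj
    · interval_cases j
      norm_num
    · induction j, hj using Nat.le_induction with
      | base => norm_num
      | succ j hj ih =>
        have : (1 : ℝ) ≤ j := by exact_mod_cast hj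
        rw [pow_succ]
        push_cast
        linarith
  calc _ ≤ ∫⁻ x in (Set.Ioc (c - L) (c + L))ᶜ, ∑' j, q j x :=
        setLIntegral_mono' measurableSet_Ioc.compl hpt
    _ ≤ ∫⁻ x, ∑' j, q j x := setLIntegral_le_lintegral _ _
    _ = ∑' j, ∫⁻ x, q j x := by
        refine lintegral_tsum fun j => ?_
        exact ((haes.norm.aemeasurable.const_mul _).ennreal_ofReal).indicator measurableSet_Ioc
    _ ≤ ∑' j : ℕ, ENNReal.ofReal (16 * D / L * (3 / 4 : ℝ) ^ j) := by
        refine ENNReal.tsum_le_tsum fun j => ?_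
        rw [hq]
        simp only
        rw [lintegral_indicator measurableSet_Ioc, ← ofReal_integral_eq_lintegral_ofReal]
        · refine ENNReal.ofReal_le_ofReal ?_
          rw [integral_const_mul]
          have h1 := h.setIntegral_norm_sub_avg_le hf hD c hL (j + 1)
          rw [← hm] at h1
          calc _ ≤ ((2 ^ j * L) ^ 2)⁻¹ * (D * (2 * 2 ^ (j + 1) * L) * (1 + 2 * (j + 1 : ℕ))) := by gcongr
            _ = 4 * D / L * ((2 : ℝ) ^ j)⁻¹ * (2 * j + 3) := by
                rw [pow_succ]
                push_cast
                field_simp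
                ring
            _ ≤ 4 * D / L * ((2 : ℝ) ^ j)⁻¹ * (4 * (3 / 2) ^ j) := by
                gcongr
                exact hnum j
            _ = 16 * D / L * (3 / 4 : ℝ) ^ j := by
                have : (3 / 4 : ℝ) ^ j = (3 / 2) ^ j * ((2 : ℝ) ^ j)⁻¹ := by
                  rw [← inv_pow, ← mul_pow]
                  norm_num
                rw [this]
                ring
        · exact (((hf.sub_const m).integrableOn _ _).norm.const_mul _)
        · exact ae_of_all _ fun x => by positivity
    _ = ENNReal.ofReal (64 * D / L) := by
        rw [← ENNReal.ofReal_tsum_of_nonneg (fun j => by positivity) hgeo.summable, hgeo.tsum_eq]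

end Weighted

/-! ### Wavelet coefficients of functions of bounded mean oscillation -/

namespace DyadicInterval

variable {I J : DyadicInterval}

lemma subset_iff : I.toSet ⊆ J.toSet ↔
    J.pos * J.length ≤ I.pos * I.length ∧ (I.pos + 1) * I.length ≤ (J.pos + 1) * J.length := by
  have hl := I.length_pos
  rw [toSet, toSet, Set.Ico_subset_Ico_iff (by nlinarith)]

lemma length_le_of_subset (h : I.toSet ⊆ J.toSet) : I.length ≤ J.length := by
  obtain ⟨h1, h2⟩ := subset_iff.1 h
  linarith

lemma abs_center_sub_le_of_subset (h : I.toSet ⊆ J.toSet) :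
    |J.center - I.center| ≤ J.length / 2 := by
  obtain ⟨h1, h2⟩ := subset_iff.1 h
  have hl := I.length_pos
  rw [center, center, abs_le]
  constructor <;> linarith

lemma length_eq (N : ℤ) : I.length = 2 ^ (I.scale - N) * 2 ^ N := by
  rw [length, ← zpow_add₀ two_ne_zero, sub_add_cancel]

lemma length_eq_of_le {N : ℤ} (h : I.scale ≤ N) :
    I.length = (1 / 2 : ℝ) ^ (I.scale - N).natAbs * 2 ^ N := by
  rw [I.length_eq N]
  congr 1
  obtain ⟨k, hk⟩ := Int.eq_ofNat_of_zero_le (sub_nonneg.2 h)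
  have : I.scale - N = -(k : ℤ) := by omega
  rw [this, Int.natAbs_neg, Int.natAbs_natCast, zpow_neg, zpow_natCast, one_div, inv_pow]

lemma length_le_iff {N : ℤ} : I.length ≤ 2 ^ N ↔ I.scale ≤ N := zpow_le_zpow_iff_right₀ one_lt_two

end DyadicInterval

/-- Inside `J` the distance from `c_J` to `c_I` is at most `|J| / 2`, so the weight is at least a
multiple of `(|I| / |J|)³`. This makes the tail coefficients summable. -/
lemma length_pow_three_le_dyadicWeight {I J : DyadicInterval} (h : I.toSet ⊆ J.toSet) :
    I.length ^ 3 / J.length ^ 2 ≤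
      4 * J.length * dyadicWeight (1 / 2) J.scale J.center I := by
  have hl := I.length_pos
  have hL := J.length_pos
  have hle := DyadicInterval.length_le_of_subset h
  have hs : I.scale ≤ J.scale := DyadicInterval.length_le_iff.1 hle
  have e : I.length = (1 / 2 : ℝ) ^ (I.scale - J.scale).natAbs * J.length :=
    DyadicInterval.length_eq_of_le hs
  have e' : (1 / 2 : ℝ) ^ (I.scale - J.scale).natAbs = I.length / J.length := by
    rw [eq_div_iff hL.ne', ← e]
  rw [dyadicWeight, e']
  have ht : 1 + I.relDist J.center ≤ 2 * (J.length / I.length) := by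
    rw [I.relDist_eq]
    have h1 : |J.center - I.center| / I.length ≤ J.length / 2 / I.length := by
      gcongr
      exact DyadicInterval.abs_center_sub_le_of_subset h
    have h2 : 1 ≤ J.length / I.length := (one_le_div hl).2 hle
    have h3 : J.length / 2 / I.length = J.length / I.length / 2 := by ring
    linarith
  have ht0 := I.relDist_nonneg J.center
  calc I.length ^ 3 / J.length ^ 2 = 4 * J.length * (I.length / J.length * ((2 * (J.length / I.length)) ^ 2)⁻¹) := by
        field_simp
        ring
    _ ≤ _ := by gcongr

section

variable {K : Type u} [NormedAddCommGroup K] [InnerProductSpace ℂ K] [CompleteSpace K]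
  {f : ℝ → K} {D : ℝ}

/-- The centre of `I` is within `L / 2` of `c`, so `|x - c_I| ≥ |x - c| / 2` off the doubled
interval. Two of the six powers of decay then bound `w_I` by a multiple of `|x - c|⁻²`, the kernel
of the tail estimate. -/
lemma OscBound.norm_vcoeff_tail_le (h : OscBound f D) (hf : WeightedL2 f) (hD : 0 ≤ D)
    {w : 𝓢(ℝ, ℂ)} {C : ℝ} (hC0 : 0 < C) (hC : ∀ x, ‖w x‖ ≤ C * ((1 + |x|) ^ 6)⁻¹)
    {I J : DyadicInterval} (hIJ : I.toSet ⊆ J.toSet) :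
    ‖vcoeff w ((Set.Ioc (J.center - J.length) (J.center + J.length))ᶜ.indicator
      fun x => f x - avg f (J.center - J.length) (J.center + J.length)) I‖ ^ 2 ≤
      (256 * C * D) ^ 2 * (I.length ^ 3 / J.length ^ 2) := by
  set c := J.center
  set L := J.length
  set ℓ := I.length with hℓ
  have hl : 0 < ℓ := I.length_pos
  have hL : 0 < L := J.length_pos
  set m := avg f (c - L) (c + L)
  have hcc : |c - I.center| ≤ L / 2 := DyadicInterval.abs_center_sub_le_of_subset hIJ
  set B : ℝ := C * (Real.sqrt ℓ)⁻¹ * (4 * ℓ ^ 2) with hB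
  have hB0 : 0 ≤ B := by positivity
  have hw : ∀ x ∈ (Set.Ioc (c - L) (c + L))ᶜ, ‖wavelet w I x‖ ≤ B * ((x - c) ^ 2)⁻¹ := by
    intro x hx
    have hxL : L ≤ |x - c| := by
      by_contra! hlt
      rw [abs_lt] at hlt
      exact hx ⟨by linarith, by linarith⟩
    have hx2 : |x - c| / 2 ≤ |x - I.center| := by
      have := abs_sub_abs_le_abs_sub (x - c) (I.center - c)
      rw [show x - c - (I.center - c) = x - I.center by ring, abs_sub_comm I.center c] at this
      linarith
    have hx0 : 0 < |x - c| := by linarith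
    have ht : |x - c| / (2 * ℓ) ≤ I.relDist x := by
      rw [I.relDist_eq, ← div_div]
      gcongr
    have ht0 : 0 < |x - c| / (2 * ℓ) := by positivity
    refine (norm_wavelet_le hC I x).trans ?_
    rw [hB, mul_assoc (C * (Real.sqrt ℓ)⁻¹)]
    gcongr
    calc ((1 + I.relDist x) ^ 6)⁻¹ ≤ ((1 + I.relDist x) ^ 2)⁻¹ := by
          have := I.relDist_nonneg x
          gcongr
          · linarith
          · norm_num
      _ ≤ ((|x - c| / (2 * ℓ)) ^ 2)⁻¹ := by
          gcongr
          linarith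
      _ = 4 * ℓ ^ 2 * ((x - c) ^ 2)⁻¹ := by
          rw [div_pow, inv_div, sq_abs]
          ring
  have hmain : ‖vcoeff w ((Set.Ioc (c - L) (c + L))ᶜ.indicator fun x => f x - m) I‖ ≤
      B * (64 * D / L) := by
    have h1 : ‖vcoeff w ((Set.Ioc (c - L) (c + L))ᶜ.indicator fun x => f x - m) I‖ₑ ≤
        ENNReal.ofReal (B * (64 * D / L)) := by
      calc _ ≤ ∫⁻ x, ‖conj (wavelet w I x) •
              (Set.Ioc (c - L) (c + L))ᶜ.indicator (fun x => f x - m) x‖ₑ :=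
            enorm_integral_le_lintegral_enorm _
        _ = ∫⁻ x in (Set.Ioc (c - L) (c + L))ᶜ, ‖conj (wavelet w I x) • (f x - m)‖ₑ := by
            rw [← lintegral_indicator measurableSet_Ioc.compl]
            congr 1
            funext x
            by_cases hx : x ∈ (Set.Ioc (c - L) (c + L))ᶜ
            · rw [Set.indicator_of_mem hx, Set.indicator_of_mem hx]
            · rw [Set.indicator_of_notMem hx, Set.indicator_of_notMem hx, smul_zero, enorm_zero]
        _ ≤ ∫⁻ x in (Set.Ioc (c - L) (c + L))ᶜ,
              ENNReal.ofReal B * ENNReal.ofReal (((x - c) ^ 2)⁻¹ * ‖f x - m‖) := by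
            refine setLIntegral_mono' measurableSet_Ioc.compl fun x hx => ?_
            rw [← ENNReal.ofReal_mul hB0, ← ofReal_norm, norm_smul, RCLike.norm_conj, ← mul_assoc]
            refine ENNReal.ofReal_le_ofReal ?_
            gcongr
            exact hw x hx
        _ = ENNReal.ofReal B * ∫⁻ x in (Set.Ioc (c - L) (c + L))ᶜ,
              ENNReal.ofReal (((x - c) ^ 2)⁻¹ * ‖f x - m‖) :=
            lintegral_const_mul' _ _ ENNReal.ofReal_ne_top
        _ ≤ _ := by
            rw [ENNReal.ofReal_mul hB0]
            gcongr
            exact h.lintegral_tail_le hf hD c hL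
    rw [← ofReal_norm] at h1
    exact (ENNReal.ofReal_le_ofReal_iff (by positivity)).1 h1
  calc _ ≤ (B * (64 * D / L)) ^ 2 := by gcongr
    _ = (256 * C * D) ^ 2 * (((Real.sqrt ℓ)⁻¹) ^ 2 * ℓ ^ 4 / L ^ 2) := by
        rw [hB]
        field_simp
        ring
    _ = _ := by
        rw [inv_pow, Real.sq_sqrt hl.le]
        field_simp

end

/-- The wavelet coefficients of a function of bounded mean oscillation satisfy the Carleson
condition. -/
theorem IsWaveletBasis.exists_carleson_le_osc {w : 𝓢(ℝ, ℂ)} (hw : IsWaveletBasis w) :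
    ∃ C : ℝ, 0 < C ∧ ∀ (K : Type u) [NormedAddCommGroup K] [InnerProductSpace ℂ K] [CompleteSpace K]
      (f : ℝ → K) (D : ℝ), WeightedL2 f → 0 ≤ D → OscBound f D →
      ∀ (J : DyadicInterval) (S : Finset DyadicInterval), (∀ I ∈ S, I.toSet ⊆ J.toSet) →
        ∑ I ∈ S, ‖vcoeff w f I‖ ^ 2 ≤ C * D ^ 2 * J.length := by
  obtain ⟨C, hC0, hC, -⟩ := exists_decay w
  obtain ⟨C1, hC1, hS⟩ := exists_sum_dyadicWeight_le (r := 1 / 2) (by norm_num) (by norm_num)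
  refine ⟨4 + 2 * (256 * C) ^ 2 * 4 * C1, by positivity, fun K _ _ _ f D hf hD h J S hJ => ?_⟩
  set c := J.center with hc
  set L := J.length with hLdef
  have hL : 0 < L := J.length_pos
  -- The mean is taken over the double of `J`, so that the remaining part of `f` lives at distance
  -- at least `L / 2` from `J`.
  set m := avg f (c - L) (c + L) with hm
  set s := Set.Ioc (c - L) (c + L) with hs
  have hg := hf.sub_const m
  have hsplit : ∀ I, vcoeff w f I =
      vcoeff w (s.indicator fun x => f x - m) I + vcoeff w (sᶜ.indicator fun x => f x - m) I := by
    intro I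
    rw [← vcoeff_eq_add_indicator I hg measurableSet_Ioc, hw.vcoeff_sub_const I hf]
  have hloc : ∑ I ∈ S, ‖vcoeff w (s.indicator fun x => f x - m) I‖ ^ 2 ≤ D ^ 2 * (2 * L) := by
    refine (sum_le_hasSum S (fun _ _ => sq_nonneg _) (hw.hasSum_norm_vcoeff_sq (hg.memLp_Ioc _ _))).trans ?_
    have e : (fun x => ‖s.indicator (fun x => f x - m) x‖ ^ 2) = s.indicator fun x => ‖f x - m‖ ^ 2 := by
      funext x
      by_cases hx : x ∈ s <;> simp [hx]
    rw [← hs, e, integral_indicator measurableSet_Ioc]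
    refine (h (c - L) (c + L) (by linarith)).trans (le_of_eq ?_)
    ring
  have hfar : ∑ I ∈ S, ‖vcoeff w (sᶜ.indicator fun x => f x - m) I‖ ^ 2 ≤
      (256 * C * D) ^ 2 * (4 * L * C1) := by
    calc _ ≤ ∑ I ∈ S, (256 * C * D) ^ 2 * (4 * L * dyadicWeight (1 / 2) J.scale c I) := by
          refine Finset.sum_le_sum fun I hI => ?_
          refine (h.norm_vcoeff_tail_le hf hD hC0 hC (hJ I hI)).trans ?_
          gcongr
          exact length_pow_three_le_dyadicWeight (hJ I hI)
      _ = (256 * C * D) ^ 2 * (4 * L * ∑ I ∈ S, dyadicWeight (1 / 2) J.scale c I) := by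
          rw [Finset.mul_sum, Finset.mul_sum]
      _ ≤ _ := by
          gcongr
          exact hS _ _ _
  calc ∑ I ∈ S, ‖vcoeff w f I‖ ^ 2
      ≤ ∑ I ∈ S, (2 * ‖vcoeff w (s.indicator fun x => f x - m) I‖ ^ 2 +
          2 * ‖vcoeff w (sᶜ.indicator fun x => f x - m) I‖ ^ 2) := by
        refine Finset.sum_le_sum fun I _ => ?_
        rw [hsplit]
        have := norm_add_le (vcoeff w (s.indicator fun x => f x - m) I)
          (vcoeff w (sᶜ.indicator fun x => f x - m) I)
        calc _ ≤ (‖vcoeff w (s.indicator fun x => f x - m) I‖ +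
              ‖vcoeff w (sᶜ.indicator fun x => f x - m) I‖) ^ 2 := by gcongr
          _ ≤ _ := by nlinarith [sq_nonneg (‖vcoeff w (s.indicator fun x => f x - m) I‖ -
              ‖vcoeff w (sᶜ.indicator fun x => f x - m) I‖)]
    _ ≤ 2 * (D ^ 2 * (2 * L)) + 2 * ((256 * C * D) ^ 2 * (4 * L * C1)) := by
        rw [Finset.sum_add_distrib, ← Finset.mul_sum, ← Finset.mul_sum]
        gcongr
    _ = _ := by ring

section

variable {K : Type u} [NormedAddCommGroup K] [InnerProductSpace ℂ K]

/-! ### Wavelet coefficients of local functions of mean zero -/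

/-- `F` is integrable, lives on `(a, a + L]` and has mean zero. -/
structure IsLocalMeanZero (F : ℝ → K) (a L : ℝ) : Prop where
  int : Integrable F
  supp : ∀ x, F x ≠ 0 → x ∈ Set.Ioc a (a + L)
  mean : ∫ x, F x = 0

lemma norm_vcoeff_le_of_forall_le {w : 𝓢(ℝ, ℂ)} {I : DyadicInterval} {F : ℝ → K} {B : ℝ}
    (hF : Integrable F) (h : ∀ x, F x ≠ 0 → ‖wavelet w I x‖ ≤ B) :
    ‖vcoeff w F I‖ ≤ B * ∫ x, ‖F x‖ := by
  rw [← integral_const_mul]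
  refine norm_integral_le_of_norm_le (hF.norm.const_mul B) (ae_of_all _ fun x => ?_)
  rw [norm_smul, RCLike.norm_conj]
  by_cases hx : F x = 0
  · simp [hx]
  · gcongr
    exact h x hx

/-- Constants integrate to zero against `F`. This is used for long `I`, on which the wavelet is
nearly constant over the support of `F`. -/
lemma vcoeff_eq_of_mean_zero [CompleteSpace K] (w : 𝓢(ℝ, ℂ)) (I : DyadicInterval) {F : ℝ → K} (a : ℝ)
    (hF : Integrable F) (h0 : ∫ x, F x = 0) :
    vcoeff w F I = ∫ x, conj (wavelet w I x - wavelet w I a) • F x := by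
  obtain ⟨C, hC0, hC, -⟩ := exists_decay w
  have h1 : Integrable fun x => conj (wavelet w I x) • F x := by
    refine (hF.norm.const_mul (C * (Real.sqrt I.length)⁻¹)).mono' ?_ (ae_of_all _ fun x => ?_)
    · exact (Complex.continuous_conj.comp (continuous_wavelet w I)).aestronglyMeasurable.smul
        hF.aestronglyMeasurable
    · rw [norm_smul, RCLike.norm_conj]
      gcongr
      refine (norm_wavelet_le hC I x).trans (mul_le_of_le_one_right (by positivity)
        (inv_le_one_of_one_le₀ (one_le_pow₀ ?_)))
      linarith [I.relDist_nonneg x]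
  have h2 : Integrable fun x => conj (wavelet w I a) • F x := hF.smul _
  simp only [map_sub, sub_smul]
  rw [integral_sub h1 h2, integral_smul, h0, smul_zero, sub_zero, vcoeff]

namespace IsLocalMeanZero

variable {F : ℝ → K} {a L : ℝ} {w : 𝓢(ℝ, ℂ)} {C : ℝ}

lemma norm_vcoeff_le (hF : IsLocalMeanZero F a L) (hC0 : 0 < C)
    (hC : ∀ x, ‖w x‖ ≤ C * ((1 + |x|) ^ 6)⁻¹) (I : DyadicInterval) :
    ‖vcoeff w F I‖ ≤ C * (Real.sqrt I.length)⁻¹ * ∫ x, ‖F x‖ := by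
  refine norm_vcoeff_le_of_forall_le hF.int fun x _ => ?_
  refine (norm_wavelet_le hC I x).trans (mul_le_of_le_one_right (by positivity)
    (inv_le_one_of_one_le₀ (one_le_pow₀ ?_)))
  linarith [I.relDist_nonneg x]

/-- Moving from `a` to a point of the support changes the distance to `c_I` by at most one half of
it; `64 = 2 ^ 6` is the price in the decay. -/
lemma norm_vcoeff_le_of_far (hF : IsLocalMeanZero F a L) (hC0 : 0 < C)
    (hC : ∀ x, ‖w x‖ ≤ C * ((1 + |x|) ^ 6)⁻¹) {I : DyadicInterval}
    (hI : 2 * L ≤ I.relDist a * I.length) :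
    ‖vcoeff w F I‖ ≤ 64 * C * (Real.sqrt I.length)⁻¹ * ((1 + I.relDist a) ^ 6)⁻¹ * ∫ x, ‖F x‖ := by
  refine norm_vcoeff_le_of_forall_le hF.int fun x hx => ?_
  have hl := I.length_pos
  obtain ⟨h1, h2⟩ := hF.supp x hx
  have ht : I.relDist a / 2 ≤ I.relDist x := by
    rw [I.relDist_eq a, div_mul_cancel₀ _ hl.ne'] at hI
    rw [I.relDist_eq, I.relDist_eq, div_right_comm]
    gcongr
    have h3 := abs_sub_abs_le_abs_sub (a - I.center) (x - I.center)
    rw [show a - I.center - (x - I.center) = -(x - a) by ring, abs_neg] at h3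
    have h4 : |x - a| = x - a := abs_of_pos (by linarith)
    linarith
  have ht0 := I.relDist_nonneg a
  calc ‖wavelet w I x‖ ≤ C * (Real.sqrt I.length)⁻¹ * ((1 + I.relDist x) ^ 6)⁻¹ := norm_wavelet_le hC I x
    _ ≤ C * (Real.sqrt I.length)⁻¹ * (((1 + I.relDist a) / 2) ^ 6)⁻¹ := by
        gcongr
        linarith
    _ = _ := by
        rw [div_pow, inv_div]
        ring

lemma norm_vcoeff_le_of_large [CompleteSpace K] (hF : IsLocalMeanZero F a L) (hC0 : 0 < C)
    (hC : ∀ x y, |x - y| ≤ 1 → ‖w x - w y‖ ≤ C * |x - y| * ((1 + |x|) ^ 6)⁻¹) {I : DyadicInterval}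
    (hI : L ≤ I.length) :
    ‖vcoeff w F I‖ ≤
      C * (Real.sqrt I.length)⁻¹ * (L / I.length) * ((1 + I.relDist a) ^ 6)⁻¹ * ∫ x, ‖F x‖ := by
  have hl := I.length_pos
  rw [vcoeff_eq_of_mean_zero w I a hF.int hF.mean, ← integral_const_mul]
  refine norm_integral_le_of_norm_le (hF.int.norm.const_mul _) (ae_of_all _ fun x => ?_)
  rw [norm_smul, RCLike.norm_conj]
  by_cases hx : F x = 0
  · simp [hx]
  · obtain ⟨h1, h2⟩ := hF.supp x hx
    have h3 : |a - x| ≤ L := by rw [abs_le]; constructor <;> linarith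
    have ht0 := I.relDist_nonneg a
    gcongr
    rw [norm_sub_rev]
    refine (norm_wavelet_sub_le hC I (h3.trans hI)).trans ?_
    gcongr

end IsLocalMeanZero

/-! ### Pairing with functions that vanish near the support -/

/-- The twelve powers of decay in `‖w_I‖²` are shared out: two pay for the weight through `M`, eight
produce `ε ^ 2`, and two leave the integrable kernel of the weighted Cauchy–Schwarz inequality. -/
lemma weight_mul_norm_wavelet_sq_le {w : 𝓢(ℝ, ℂ)} {C : ℝ} (hC0 : 0 < C)
    (hC : ∀ x, ‖w x‖ ≤ C * ((1 + |x|) ^ 6)⁻¹) (I : DyadicInterval) {a x M ε : ℝ}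
    (hM : 1 + |x - a| ≤ M * (1 + I.relDist x))
    (hε : 1 ≤ ε * (1 + I.relDist x) ^ 4) :
    (1 + x ^ 2) * ‖wavelet w I x‖ ^ 2 ≤ (2 * (1 + a ^ 2) * C * M * ε) ^ 2 *
      (I.length⁻¹ * (1 + ((x - I.center) / I.length) ^ 2)⁻¹) := by
  have hl := I.length_pos
  have h1 := norm_wavelet_le hC I x
  have h2 := one_add_sq_le a x
  have hy : ((x - I.center) / I.length) ^ 2 = I.relDist x ^ 2 := by rw [DyadicInterval.relDist, sq_abs]
  rw [hy]
  set y := I.relDist x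
  have hy0 : 0 ≤ y := I.relDist_nonneg x
  have hs : ((Real.sqrt I.length)⁻¹) ^ 2 = I.length⁻¹ := by rw [inv_pow, Real.sq_sqrt hl.le]
  have h3 : (1 + y) ^ 2 * (((1 + y) ^ 6)⁻¹) ^ 2 ≤ ε ^ 2 * (1 + y ^ 2)⁻¹ := by
    have e : (1 + y) ^ 2 * (((1 + y) ^ 6)⁻¹) ^ 2 = (((1 + y) ^ 4)⁻¹) ^ 2 * ((1 + y) ^ 2)⁻¹ := by field_simp
    rw [e]
    have : ((1 + y) ^ 4)⁻¹ ≤ ε := by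
      rw [inv_eq_one_div, div_le_iff₀ (by positivity)]
      exact hε
    gcongr
    nlinarith
  have ha : 2 * (1 + a ^ 2) ≤ (2 * (1 + a ^ 2)) ^ 2 := by nlinarith [sq_nonneg a]
  have hM2 : (1 + |x - a|) ^ 2 ≤ (M * (1 + y)) ^ 2 := by gcongr
  calc (1 + x ^ 2) * ‖wavelet w I x‖ ^ 2
      ≤ ((2 * (1 + a ^ 2)) ^ 2 * (M * (1 + y)) ^ 2) * (C * (Real.sqrt I.length)⁻¹ * ((1 + y) ^ 6)⁻¹) ^ 2 := by
        gcongr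
        exact h2.trans (by gcongr)
    _ = (2 * (1 + a ^ 2)) ^ 2 * M ^ 2 * C ^ 2 * ((Real.sqrt I.length)⁻¹) ^ 2 *
        ((1 + y) ^ 2 * (((1 + y) ^ 6)⁻¹) ^ 2) := by ring
    _ ≤ (2 * (1 + a ^ 2)) ^ 2 * M ^ 2 * C ^ 2 * ((Real.sqrt I.length)⁻¹) ^ 2 * (ε ^ 2 * (1 + y ^ 2)⁻¹) := by
        gcongr
    _ = _ := by
        rw [hs]
        ring

lemma DyadicInterval.abs_sub_le_relDist (I : DyadicInterval) (a x : ℝ) :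
    |x - a| ≤ (I.relDist x + I.relDist a) * I.length := by
  have hl := I.length_pos
  rw [I.relDist_eq, I.relDist_eq, ← add_div, div_mul_cancel₀ _ hl.ne', abs_sub_comm a]
  exact abs_sub_le _ _ _

omit [InnerProductSpace ℂ K] in
lemma integral_wavelet_mul_le_of_large {w : 𝓢(ℝ, ℂ)} {C : ℝ} (hC0 : 0 < C)
    (hC : ∀ x, ‖w x‖ ≤ C * ((1 + |x|) ^ 6)⁻¹) {g : ℝ → K} (hg : WeightedL2 g) {a L : ℝ} (hL : 0 < L)
    {I : DyadicInterval} (hI : L ≤ I.length) :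
    ∫ x, ‖wavelet w I x‖ * ‖g x‖ ≤ 2 * (1 + a ^ 2) * C * ((1 + L⁻¹) * (I.length * (1 + I.relDist a))) *
      (Real.pi + ∫ x, ‖g x‖ ^ 2 * (1 + x ^ 2)⁻¹) := by
  have hl := I.length_pos
  have ht0 := I.relDist_nonneg a
  refine (hg.integral_wavelet_mul_le w I (by positivity) fun x _ => ?_).2
  have hy0 := I.relDist_nonneg x
  have := weight_mul_norm_wavelet_sq_le hC0 hC I (a := a) (x := x)
    (M := (1 + L⁻¹) * (I.length * (1 + I.relDist a))) (ε := 1) ?_ ?_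
  · rwa [mul_one] at this
  · have h1 := I.abs_sub_le_relDist a x
    have h2 : 1 ≤ L⁻¹ * I.length := by
      rw [inv_mul_eq_div, one_le_div hL]
      exact hI
    have h3 : 1 ≤ (1 + I.relDist a) * (1 + I.relDist x) := by nlinarith
    have h4 : I.relDist x + I.relDist a ≤ (1 + I.relDist a) * (1 + I.relDist x) := by nlinarith
    calc 1 + |x - a| ≤ (L⁻¹ * I.length) * ((1 + I.relDist a) * (1 + I.relDist x)) +
          ((1 + I.relDist a) * (1 + I.relDist x)) * I.length := by
          gcongr
          · nlinarith
          · exact h1.trans (by gcongr)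
      _ = _ := by ring
  · rw [one_mul]
    exact one_le_pow₀ (by linarith)

omit [InnerProductSpace ℂ K] in
-- The factor `ε` measures how far `g` lives from `I` in units of `|I|`. It supplies smallness for
-- short intervals near the support of `F`, where `F` gives none.
lemma integral_wavelet_mul_le_of_small {w : 𝓢(ℝ, ℂ)} {C : ℝ} (hC0 : 0 < C)
    (hC : ∀ x, ‖w x‖ ≤ C * ((1 + |x|) ^ 6)⁻¹) {g : ℝ → K} (hg : WeightedL2 g) {a M ε : ℝ}
    {I : DyadicInterval} (hI : I.length ≤ M) (hε0 : 0 < ε)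
    (hε : ∀ x, g x ≠ 0 → 1 ≤ ε * (1 + I.relDist x) ^ 4) :
    ∫ x, ‖wavelet w I x‖ * ‖g x‖ ≤ 2 * (1 + a ^ 2) * C * ((1 + M) * (1 + I.relDist a)) * ε *
      (Real.pi + ∫ x, ‖g x‖ ^ 2 * (1 + x ^ 2)⁻¹) := by
  have hl := I.length_pos
  have ht0 := I.relDist_nonneg a
  have hM0 : 0 < M := hl.trans_le hI
  refine (hg.integral_wavelet_mul_le w I (by positivity) fun x hx => ?_).2
  have hy0 := I.relDist_nonneg x
  refine weight_mul_norm_wavelet_sq_le hC0 hC I (a := a) (x := x) ?_ (hε x hx)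
  have h1 := I.abs_sub_le_relDist a x
  have h3 : 1 ≤ (1 + I.relDist a) * (1 + I.relDist x) := by nlinarith
  have h4 : I.relDist x + I.relDist a ≤ (1 + I.relDist a) * (1 + I.relDist x) := by nlinarith
  calc 1 + |x - a| ≤ (1 + I.relDist a) * (1 + I.relDist x) +
        ((1 + I.relDist a) * (1 + I.relDist x)) * M := by
        gcongr
        exact h1.trans (by gcongr)
    _ = _ := by ring

end

/-! ### The reproducing formula for local functions of mean zero -/

lemma DyadicInterval.sqrt_length_of_le {I : DyadicInterval} {N : ℤ} (h : I.scale ≤ N) :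
    Real.sqrt I.length = Real.sqrt (2 ^ N) * Real.sqrt (1 / 2) ^ (I.scale - N).natAbs := by
  rw [DyadicInterval.length_eq_of_le h, Real.sqrt_mul (by positivity), mul_comm]
  congr 1
  rw [Real.sqrt_eq_iff_mul_self_eq (by positivity) (by positivity), ← mul_pow,
    Real.mul_self_sqrt (by norm_num)]

lemma DyadicInterval.inv_length_of_lt {I : DyadicInterval} {N : ℤ} (h : N ≤ I.scale) :
    2 ^ N / I.length = (1 / 2 : ℝ) ^ (I.scale - N).natAbs := by
  rw [I.length_eq N]
  obtain ⟨k, hk⟩ := Int.eq_ofNat_of_zero_le (sub_nonneg.2 h)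
  have h2 : (2 : ℝ) ^ N ≠ 0 := zpow_ne_zero _ two_ne_zero
  rw [hk, Int.natAbs_natCast, zpow_natCast, one_div, inv_pow]
  field_simp

lemma DyadicInterval.inv_sqrt_length_of_lt {I : DyadicInterval} {N : ℤ} (h : N ≤ I.scale) :
    (Real.sqrt I.length)⁻¹ = (Real.sqrt (2 ^ N))⁻¹ * Real.sqrt (1 / 2) ^ (I.scale - N).natAbs := by
  have h2 : (0 : ℝ) < 2 ^ N := zpow_pos two_pos _
  have hl := I.length_pos
  have e : (Real.sqrt I.length)⁻¹ = Real.sqrt ((2 ^ N)⁻¹ * (2 ^ N / I.length)) := by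
    rw [← Real.sqrt_inv]
    congr 1
    field_simp
  rw [e, DyadicInterval.inv_length_of_lt h, Real.sqrt_mul (by positivity), Real.sqrt_inv]
  congr 1
  rw [Real.sqrt_eq_iff_mul_self_eq (by positivity) (by positivity), ← mul_pow,
    Real.mul_self_sqrt (by norm_num)]

section

variable {K : Type u} [NormedAddCommGroup K] [InnerProductSpace ℂ K] [CompleteSpace K]
  {F : ℝ → K} {a L : ℝ} {w : 𝓢(ℝ, ℂ)}

/-- The products of the wavelet coefficients of `F` with those of a function vanishing near the
support of `F` are summable. -/
lemma IsLocalMeanZero.exists_norm_vcoeff_mul_le (hF : IsLocalMeanZero F a L) (hL : 0 < L) {N : ℤ}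
    (hN1 : L ≤ 2 ^ N) (hN2 : 2 ^ N ≤ 2 * L) {g : ℝ → K} (hg : WeightedL2 g)
    (hga : ∀ x, g x ≠ 0 → 4 * L ≤ |x - a|) :
    ∃ B : ℝ, ∀ I, ‖vcoeff w F I‖ * ∫ x, ‖wavelet w I x‖ * ‖g x‖ ≤
      B * dyadicWeight (Real.sqrt (1 / 2)) N a I := by
  obtain ⟨C, hC0, hC, hC'⟩ := exists_decay w
  set X := ∫ x, ‖F x‖ with hX
  have hX0 : 0 ≤ X := integral_nonneg fun _ => norm_nonneg _
  set E := Real.pi + ∫ x, ‖g x‖ ^ 2 * (1 + x ^ 2)⁻¹ with hE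
  have hE0 : 0 ≤ E := add_nonneg Real.pi_pos.le (integral_nonneg fun _ => by positivity)
  set κ := 2 * (1 + a ^ 2) * C with hκ
  have hκ0 : 0 < κ := by positivity
  have h2N : (0 : ℝ) < 2 ^ N := zpow_pos two_pos _
  -- The first summand serves the intervals longer than `2 ^ N`, the second all others. The ratio
  -- `√(1 / 2)` per scale comes from a surviving factor `|I|^{∓1/2}`.
  refine ⟨C * X * κ * (1 + L⁻¹) * L * E * (Real.sqrt (2 ^ N))⁻¹ +
    64 * C * X * κ * (1 + 2 ^ N) * E / (2 * L) * Real.sqrt (2 ^ N), fun I => ?_⟩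
  have hl := I.length_pos
  have hsl : 0 < Real.sqrt I.length := Real.sqrt_pos.2 hl
  have hss : I.length = Real.sqrt I.length * Real.sqrt I.length := (Real.mul_self_sqrt hl.le).symm
  set t := I.relDist a with ht
  have ht0 : 0 ≤ t := I.relDist_nonneg a
  have hI0 : 0 ≤ ∫ x, ‖wavelet w I x‖ * ‖g x‖ := integral_nonneg fun _ => by positivity
  rw [add_mul, dyadicWeight]
  set P := (Real.sqrt (1 / 2)) ^ (I.scale - N).natAbs with hP
  have hP0 : 0 ≤ P := by positivity
  rcases le_or_gt I.scale N with hs | hs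
  · have hlN : I.length ≤ 2 ^ N := DyadicInterval.length_le_iff.2 hs
    have hsq : Real.sqrt I.length = Real.sqrt (2 ^ N) * P := DyadicInterval.sqrt_length_of_le hs
    refine le_add_of_nonneg_of_le (by positivity) ?_
    have hgoal : 64 * C * X * κ * (1 + 2 ^ N) * E / (2 * L) * Real.sqrt (2 ^ N) * (P * ((1 + t) ^ 2)⁻¹) =
        64 * C * X * κ * (1 + 2 ^ N) * E / (2 * L) * Real.sqrt I.length * ((1 + t) ^ 2)⁻¹ := by
      rw [hsq]; ring
    rw [hgoal]
    -- Far from `a`, a spare factor `(1 + t)⁻¹ ≤ |I| / (2 L)` from the decay of the coefficient of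
    -- `F` outweighs `|I|^{-1/2}`.
    rcases le_or_gt (2 * L) (t * I.length) with hf | hn
    · have h1 := hF.norm_vcoeff_le_of_far hC0 hC hf
      have h2 := integral_wavelet_mul_le_of_small hC0 hC hg (a := a) hlN one_pos (fun x _ => by
        rw [one_mul]
        exact one_le_pow₀ (by linarith [I.relDist_nonneg x]))
      rw [mul_one] at h2
      have h3 : (1 + t)⁻¹ ≤ I.length / (2 * L) := by
        rw [inv_eq_one_div, div_le_div_iff₀ (by positivity) (by positivity)]
        nlinarith
      calc _ ≤ (64 * C * (Real.sqrt I.length)⁻¹ * ((1 + t) ^ 6)⁻¹ * X) *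
            (κ * ((1 + 2 ^ N) * (1 + t)) * E) := by gcongr
        _ = 64 * C * X * κ * (1 + 2 ^ N) * E * (Real.sqrt I.length)⁻¹ *
            ((1 + t)⁻¹ * (((1 + t) ^ 2)⁻¹ * ((1 + t) ^ 2)⁻¹)) := by
            field_simp
        _ ≤ 64 * C * X * κ * (1 + 2 ^ N) * E * (Real.sqrt I.length)⁻¹ *
            (I.length / (2 * L) * (((1 + t) ^ 2)⁻¹ * 1)) := by
            gcongr
            exact inv_le_one_of_one_le₀ (one_le_pow₀ (by linarith))
        _ = _ := by
            nth_rewrite 2 [hss]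
            field_simp
    -- Near `a` the coefficient of `F` has only the trivial bound. Since `g` vanishes within `4 L`
    -- of `a` and `c_I` is within `2 L`, `g` lives at least `2 L` from `c_I`, which gives this `ε`.
    · have h1 := hF.norm_vcoeff_le hC0 hC I
      have h2 := integral_wavelet_mul_le_of_small hC0 hC hg (a := a) (ε := (I.length / (2 * L)) ^ 4) hlN
        (by positivity) (fun x hx => by
          have h3 := hga x hx
          have h4 := I.abs_sub_le_relDist a x
          have h5 : 2 * L ≤ I.relDist x * I.length := by linarith
          rw [← mul_pow]
          refine one_le_pow₀ ?_
          rw [div_mul_eq_mul_div, one_le_div (by positivity)]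
          linarith)
      have h3 : 1 + t ≤ 2 * ((2 * L) / I.length) := by
        rw [← mul_div_assoc, le_div_iff₀ hl]
        linarith
      have h4 : (1 + t) ^ 3 * (I.length / (2 * L)) ^ 4 ≤ 8 * (I.length / (2 * L)) := by
        calc (1 + t) ^ 3 * (I.length / (2 * L)) ^ 4 ≤ (2 * ((2 * L) / I.length)) ^ 3 * (I.length / (2 * L)) ^ 4 := by
              gcongr
          _ = _ := by
              field_simp
              norm_num
      calc _ ≤ (C * (Real.sqrt I.length)⁻¹ * X) *
            (κ * ((1 + 2 ^ N) * (1 + t)) * (I.length / (2 * L)) ^ 4 * E) := by gcongr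
        _ = C * X * κ * (1 + 2 ^ N) * E * (Real.sqrt I.length)⁻¹ * ((1 + t) ^ 2)⁻¹ *
            ((1 + t) ^ 3 * (I.length / (2 * L)) ^ 4) := by
            field_simp
        _ ≤ C * X * κ * (1 + 2 ^ N) * E * (Real.sqrt I.length)⁻¹ * ((1 + t) ^ 2)⁻¹ *
            (64 * (I.length / (2 * L))) := by
            refine mul_le_mul_of_nonneg_left (h4.trans ?_) (by positivity)
            gcongr
            norm_num
        _ = _ := by
            nth_rewrite 2 [hss]
            field_simp
  -- The growth `|I| (1 + t)` of the pairing with `g` is offset by the gain `L / |I|` from the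
  -- cancellation of `F`, so `|I|^{-1/2}` remains.
  · have hNl : 2 ^ N ≤ I.length := zpow_le_zpow_right₀ one_le_two hs.le
    have hsq : (Real.sqrt I.length)⁻¹ = (Real.sqrt (2 ^ N))⁻¹ * P :=
      DyadicInterval.inv_sqrt_length_of_lt hs.le
    refine le_add_of_le_of_nonneg ?_ (by positivity)
    have hgoal : C * X * κ * (1 + L⁻¹) * L * E * (Real.sqrt (2 ^ N))⁻¹ * (P * ((1 + t) ^ 2)⁻¹) =
        C * X * κ * (1 + L⁻¹) * L * E * (Real.sqrt I.length)⁻¹ * ((1 + t) ^ 2)⁻¹ := by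
      rw [hsq]; ring
    rw [hgoal]
    have h1 := hF.norm_vcoeff_le_of_large hC0 hC' (hN1.trans hNl)
    have h2 := integral_wavelet_mul_le_of_large hC0 hC hg (a := a) hL (hN1.trans hNl)
    have h6 : ((1 + t) ^ 6)⁻¹ * (1 + t) ≤ ((1 + t) ^ 2)⁻¹ := by
      rw [inv_mul_le_iff₀ (by positivity), ← div_eq_mul_inv, le_div_iff₀ (by positivity), ← pow_succ']
      exact pow_le_pow_right₀ (by linarith) (by norm_num)
    calc _ ≤ (C * (Real.sqrt I.length)⁻¹ * (L / I.length) * ((1 + t) ^ 6)⁻¹ * X) *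
          (κ * ((1 + L⁻¹) * (I.length * (1 + t))) * E) := by gcongr
      _ = C * X * κ * (1 + L⁻¹) * L * E * (Real.sqrt I.length)⁻¹ * (((1 + t) ^ 6)⁻¹ * (1 + t)) := by
          field_simp
      _ ≤ _ := by gcongr

omit [CompleteSpace K] in
lemma norm_vcoeff_le_integral (w : 𝓢(ℝ, ℂ)) (g : ℝ → K) (I : DyadicInterval) :
    ‖vcoeff w g I‖ ≤ ∫ x, ‖wavelet w I x‖ * ‖g x‖ := by
  refine (norm_integral_le_integral_norm _).trans (le_of_eq ?_)
  congr 1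
  funext x
  rw [norm_smul, RCLike.norm_conj]

lemma exists_zpow_near (hL : 0 < L) : ∃ N : ℤ, L ≤ 2 ^ N ∧ 2 ^ N ≤ 2 * L := by
  obtain ⟨n, h1, h2⟩ := exists_mem_Ioc_zpow hL (one_lt_two)
  refine ⟨n + 1, h2, ?_⟩
  rw [zpow_add_one₀ two_ne_zero]
  linarith

/-- Truncations of `g` lie in `L²`, where Parseval gives zero because the supports are disjoint. The
summable majorant involves only `‖g‖` and so serves all truncations at once; dominated convergence
for series passes to the limit. -/
lemma IsWaveletBasis.hasSum_inner_vcoeff_of_disjoint (hw : IsWaveletBasis w)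
    (hF : IsLocalMeanZero F a L) (hF2 : MemLp F 2 (volume : Measure ℝ)) (hL : 0 < L)
    {g : ℝ → K} (hg : WeightedL2 g) (hga : ∀ x, g x ≠ 0 → 4 * L ≤ |x - a|) :
    HasSum (fun I => inner ℂ (vcoeff w F I) (vcoeff w g I)) (0 : ℂ) := by
  obtain ⟨N, hN1, hN2⟩ := exists_zpow_near hL
  obtain ⟨B, hB⟩ := hF.exists_norm_vcoeff_mul_le (w := w) hL hN1 hN2 hg hga
  obtain ⟨_, _, hsum⟩ := exists_dyadicWeight_bound (r := Real.sqrt (1 / 2)) (Real.sqrt_nonneg _)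
    ((Real.sqrt_lt_sqrt (by norm_num) (by norm_num)).trans_eq Real.sqrt_one)
  have hS := (hsum N a).1.mul_left B
  set s : ℕ → Set ℝ := fun n => Set.Ioc (-(n : ℝ)) n with hs
  have hsg : ∀ n x, ‖(s n).indicator g x‖ ≤ ‖g x‖ := fun n x => norm_indicator_le_norm_self _ _
  have hbd : ∀ n I, ‖inner ℂ (vcoeff w F I) (vcoeff w ((s n).indicator g) I)‖ ≤
      B * dyadicWeight (Real.sqrt (1 / 2)) N a I := by
    intro n I
    refine (norm_inner_le_norm _ _).trans (le_trans ?_ (hB I))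
    gcongr
    refine (norm_vcoeff_le_integral _ _ _).trans ?_
    refine integral_mono ((hg.indicator measurableSet_Ioc).integrable_wavelet_mul I)
      (hg.integrable_wavelet_mul I) fun x => ?_
    exact mul_le_mul_of_nonneg_left (hsg n x) (norm_nonneg _)
  have hlim : ∀ I, Tendsto (fun n => inner ℂ (vcoeff w F I) (vcoeff w ((s n).indicator g) I)) atTop
      (𝓝 (inner ℂ (vcoeff w F I) (vcoeff w g I))) := by
    intro I
    refine Tendsto.inner tendsto_const_nhds ?_
    refine tendsto_integral_of_dominated_convergence (fun x => ‖wavelet w I x‖ * ‖g x‖)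
      (fun n => ((hg.indicator measurableSet_Ioc).integrable_conj_wavelet_smul I).aestronglyMeasurable)
      (hg.integrable_wavelet_mul I) (fun n => ae_of_all _ fun x => ?_) (ae_of_all _ fun x => ?_)
    · rw [norm_smul, RCLike.norm_conj]
      exact mul_le_mul_of_nonneg_left (hsg n x) (norm_nonneg _)
    · refine tendsto_const_nhds.congr' ?_
      obtain ⟨m, hm⟩ := exists_nat_gt |x|
      filter_upwards [eventually_ge_atTop m] with n hn
      have : |x| < n := hm.trans_le (by exact_mod_cast hn)
      rw [abs_lt] at this
      rw [Set.indicator_of_mem (show x ∈ s n from ⟨this.1, this.2.le⟩)]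
  have hzero : ∀ n, ∑' I, inner ℂ (vcoeff w F I) (vcoeff w ((s n).indicator g) I) = 0 := by
    intro n
    rw [(hw.hasSum_inner_vcoeff hF2 (hg.memLp_Ioc _ _)).tsum_eq]
    refine integral_eq_zero_of_ae (ae_of_all _ fun x => ?_)
    by_cases hx : F x = 0
    · simp [hx]
    · obtain ⟨h1, h2⟩ := hF.supp x hx
      have : g x = 0 := by
        by_contra hgx
        have h3 := hga x hgx
        rw [abs_of_pos (by linarith)] at h3
        linarith
      have h4 : (s n).indicator g x = 0 := by rw [Set.indicator_apply, this, ite_self]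
      simp only [hs] at h4
      simp [h4]
  have h := tendsto_tsum_of_dominated_convergence hS hlim (Eventually.of_forall hbd)
  simp_rw [hzero] at h
  have h0 := tendsto_nhds_unique h tendsto_const_nhds
  rw [← h0]
  refine (Summable.of_norm_bounded hS fun I => ?_).hasSum
  exact le_of_tendsto' (hlim I).norm fun n => hbd n I

/-- The reproducing formula, tested against a local function of mean zero. -/
lemma IsWaveletBasis.hasSum_inner_vcoeff_of_local (hw : IsWaveletBasis w)
    (hF : IsLocalMeanZero F a L) (hF2 : MemLp F 2 (volume : Measure ℝ)) (hL : 0 < L)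
    {f : ℝ → K} (hf : WeightedL2 f) :
    HasSum (fun I => inner ℂ (vcoeff w F I) (vcoeff w f I)) (∫ x, inner ℂ (F x) (f x)) := by
  -- Inside this interval `f` is square integrable and Parseval applies; the rest of `f` contributes
  -- zero.
  set s := Set.Ioc (a - 4 * L) (a + 4 * L) with hs
  have h1 := hw.hasSum_inner_vcoeff hF2 (hf.memLp_Ioc (a - 4 * L) (a + 4 * L))
  have h2 := hw.hasSum_inner_vcoeff_of_disjoint hF hF2 hL
    (hf.indicator (measurableSet_Ioc (a := a - 4 * L) (b := a + 4 * L)).compl) (fun x hx => by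
      by_contra! hlt
      rw [abs_lt] at hlt
      exact hx (Set.indicator_of_notMem (Set.notMem_compl_iff.2
        (show x ∈ Set.Ioc (a - 4 * L) (a + 4 * L) from ⟨by linarith, by linarith⟩)) _))
  have h3 := h1.add h2
  have h4 : ∀ I, inner ℂ (vcoeff w F I) (vcoeff w f I) =
      inner ℂ (vcoeff w F I) (vcoeff w (s.indicator f) I) +
        inner ℂ (vcoeff w F I) (vcoeff w (sᶜ.indicator f) I) := by
    intro I
    rw [← inner_add_right, ← vcoeff_eq_add_indicator _ hf measurableSet_Ioc]
  simp_rw [h4]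
  rw [add_zero] at h3
  convert h3 using 1
  congr 1
  funext x
  by_cases hx : F x = 0
  · simp [hx]
  · obtain ⟨h1, h2⟩ := hF.supp x hx
    rw [Set.indicator_of_mem (show x ∈ s from ⟨by linarith, by linarith⟩)]

end

/-- Every dyadic interval of scale at most `N` lies in one of scale `N`. -/
lemma DyadicInterval.subset_of_scale_le {I : DyadicInterval} {N : ℤ} (h : I.scale ≤ N) :
    I.toSet ⊆ (DyadicInterval.mk N ⌊I.center / 2 ^ N⌋).toSet := by
  rw [DyadicInterval.subset_iff]
  have hl := I.length_pos
  have h2N : (0 : ℝ) < 2 ^ N := zpow_pos two_pos _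
  obtain ⟨k, hk⟩ := Int.eq_ofNat_of_zero_le (sub_nonneg.2 h)
  have hm : (2 : ℝ) ^ N = ((2 ^ k : ℤ) : ℝ) * I.length := by
    rw [DyadicInterval.length, show N = k + I.scale by omega, zpow_add₀ two_ne_zero, zpow_natCast]
    push_cast
    rfl
  set p := ⌊I.center / 2 ^ N⌋ with hp
  have h1 := Int.floor_le (I.center / (2 : ℝ) ^ N)
  have h2 := Int.lt_floor_add_one (I.center / (2 : ℝ) ^ N)
  rw [← hp, le_div_iff₀ h2N, hm, DyadicInterval.center, ← mul_assoc] at h1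
  rw [← hp, div_lt_iff₀ h2N, hm, DyadicInterval.center, ← mul_assoc] at h2
  have h3 := le_of_mul_le_mul_right h1 hl
  have h4 := lt_of_mul_lt_mul_right h2 hl.le
  -- In units of `|I|` the ends of the large interval are integers and the centre of `I` is a
  -- half-integer, so the floor inequalities sharpen to the end points of `I`.
  have h5 : p * 2 ^ k ≤ I.pos := by
    have : ((p * 2 ^ k : ℤ) : ℝ) < ((I.pos + 1 : ℤ) : ℝ) := by push_cast at h3 ⊢; linarith
    have := Int.cast_lt.1 this
    omega
  have h6 : I.pos + 1 ≤ (p + 1) * 2 ^ k := by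
    have : ((I.pos : ℤ) : ℝ) < (((p + 1) * 2 ^ k : ℤ) : ℝ) := by push_cast at h4 ⊢; linarith
    have := Int.cast_lt.1 this
    omega
  have h5' : ((p * 2 ^ k : ℤ) : ℝ) ≤ I.pos := by exact_mod_cast h5
  have h6' : ((I.pos + 1 : ℤ) : ℝ) ≤ (((p + 1) * 2 ^ k : ℤ) : ℝ) := by exact_mod_cast h6
  have e : (DyadicInterval.mk N p).length = ((2 ^ k : ℤ) : ℝ) * I.length := hm
  rw [e]
  push_cast at h5' h6' ⊢
  constructor
  · calc (p : ℝ) * (2 ^ k * I.length) = p * 2 ^ k * I.length := by ring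
      _ ≤ _ := by gcongr
  · calc ((I.pos : ℝ) + 1) * I.length ≤ ((p + 1) * 2 ^ k) * I.length := by gcongr
      _ = _ := by ring

/-! ### From the Carleson condition to bounded mean oscillation -/

section

variable {K : Type u} [NormedAddCommGroup K] [InnerProductSpace ℂ K]
  {f F : ℝ → K} {a L A : ℝ} {w : 𝓢(ℝ, ℂ)}

/-- The Carleson condition on the wavelet coefficients of `f`. -/
def CarlesonBound (w : 𝓢(ℝ, ℂ)) (f : ℝ → K) (A : ℝ) : Prop :=
  ∀ (J : DyadicInterval) (S : Finset DyadicInterval), (∀ I ∈ S, I.toSet ⊆ J.toSet) →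
    ∑ I ∈ S, ‖vcoeff w f I‖ ^ 2 ≤ A ^ 2 * J.length

lemma CarlesonBound.norm_vcoeff_le (h : CarlesonBound w f A) (hA : 0 ≤ A) (I : DyadicInterval) :
    ‖vcoeff w f I‖ ≤ A * Real.sqrt I.length := by
  have h1 := h I {I} (by simp)
  rw [Finset.sum_singleton] at h1
  refine le_of_sq_le_sq ?_ (by positivity)
  rwa [mul_pow, Real.sq_sqrt I.length_pos.le]

/-- Centres within `2 * 2 ^ N` of `a` lie in at most five dyadic intervals of scale `N`; the
Carleson condition is applied to each. -/
lemma CarlesonBound.sum_near_le (h : CarlesonBound w f A) {N : ℤ} (hL : L ≤ 2 ^ N)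
    {S : Finset DyadicInterval} (hS : ∀ I ∈ S, I.scale ≤ N ∧ |a - I.center| < 2 * L) :
    ∑ I ∈ S, ‖vcoeff w f I‖ ^ 2 ≤ 5 * (A ^ 2 * 2 ^ N) := by
  have h2N : (0 : ℝ) < 2 ^ N := zpow_pos two_pos _
  set q := ⌊a / 2 ^ N⌋ with hq
  have hmaps : ∀ I ∈ S, ⌊I.center / 2 ^ N⌋ ∈ Finset.Icc (q - 2) (q + 2) := by
    intro I hI
    have h1 := (hS I hI).2
    rw [abs_lt] at h1
    have h2 : I.center / 2 ^ N < a / 2 ^ N + 2 := by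
      rw [div_add' _ _ _ h2N.ne']
      gcongr
      linarith
    have h3 : a / 2 ^ N - 2 ≤ I.center / 2 ^ N := by
      rw [div_sub' h2N.ne']
      gcongr
      linarith
    have h4 := Int.floor_le (a / (2 : ℝ) ^ N)
    have h5 := Int.lt_floor_add_one (a / (2 : ℝ) ^ N)
    rw [Finset.mem_Icc]
    constructor
    · rw [Int.le_floor]
      push_cast
      linarith
    · rw [← Int.lt_add_one_iff, Int.floor_lt]
      push_cast
      linarith
  rw [← Finset.sum_fiberwise_of_maps_to hmaps]
  calc _ ≤ ∑ p ∈ Finset.Icc (q - 2) (q + 2), A ^ 2 * (2 : ℝ) ^ N := by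
        refine Finset.sum_le_sum fun p _ => ?_
        refine h ⟨N, p⟩ _ fun I hI => ?_
        rw [Finset.mem_filter] at hI
        rw [← hI.2]
        exact DyadicInterval.subset_of_scale_le (hS I hI.1).1
    _ = _ := by
        rw [Finset.sum_const, Int.card_Icc, nsmul_eq_mul]
        congr 1
        rw [show q + 2 + 1 - (q - 2) = 5 by ring, show Int.toNat 5 = 5 from rfl]
        norm_num

variable [CompleteSpace K]

/-- The bound `A |I|^{1/2}` for a single coefficient of `f` cancels the factor `|I|^{-1/2}` in the
estimates for `F`. Summability comes from the distance when `I` is short and from cancellation when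
it is long. -/
lemma IsLocalMeanZero.norm_vcoeff_mul_le_far {C : ℝ} (hF : IsLocalMeanZero F a L) (hL : 0 < L) (hC0 : 0 < C)
    (hC : ∀ x, ‖w x‖ ≤ C * ((1 + |x|) ^ 6)⁻¹)
    (hC' : ∀ x y, |x - y| ≤ 1 → ‖w x - w y‖ ≤ C * |x - y| * ((1 + |x|) ^ 6)⁻¹)
    (h : CarlesonBound w f A) (hA : 0 ≤ A) {N : ℤ} (hN1 : L ≤ 2 ^ N) (hN2 : 2 ^ N ≤ 2 * L)
    {I : DyadicInterval} (hI : ¬ (I.scale ≤ N ∧ |a - I.center| < 2 * L)) :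
    ‖vcoeff w F I‖ * ‖vcoeff w f I‖ ≤
      64 * C * A * (∫ x, ‖F x‖) * dyadicWeight (1 / 2) N a I := by
  have hl := I.length_pos
  have hsl : 0 < Real.sqrt I.length := Real.sqrt_pos.2 hl
  have hX0 : 0 ≤ ∫ x, ‖F x‖ := integral_nonneg fun _ => norm_nonneg _
  have hf := h.norm_vcoeff_le hA I
  rw [dyadicWeight]
  set t := I.relDist a with ht
  have ht0 : 0 ≤ t := I.relDist_nonneg a
  have h6 : ((1 + t) ^ 6)⁻¹ ≤ (1 + t)⁻¹ * ((1 + t) ^ 2)⁻¹ := by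
    rw [← mul_inv, ← pow_succ']
    gcongr
    · linarith
    · norm_num
  have h6' : ((1 + t) ^ 6)⁻¹ ≤ ((1 + t) ^ 2)⁻¹ := by
    gcongr
    · linarith
    · norm_num
  rcases le_or_gt I.scale N with hs | hs
  · have hfar : 2 * L ≤ t * I.length := by
      rw [ht, I.relDist_eq, div_mul_cancel₀ _ hl.ne']
      by_contra! hlt
      exact hI ⟨hs, hlt⟩
    have h2N : (0 : ℝ) < 2 ^ N := zpow_pos two_pos _
    have e : (1 / 2 : ℝ) ^ (I.scale - N).natAbs = I.length / 2 ^ N := by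
      rw [eq_div_iff h2N.ne', ← DyadicInterval.length_eq_of_le hs]
    have h3 : (1 + t)⁻¹ ≤ (1 / 2 : ℝ) ^ (I.scale - N).natAbs := by
      rw [e, inv_eq_one_div, div_le_div_iff₀ (by positivity) h2N]
      nlinarith
    calc _ ≤ (64 * C * (Real.sqrt I.length)⁻¹ * ((1 + t) ^ 6)⁻¹ * ∫ x, ‖F x‖) *
          (A * Real.sqrt I.length) := by
          gcongr
          exact hF.norm_vcoeff_le_of_far hC0 hC hfar
      _ = 64 * C * A * (∫ x, ‖F x‖) * ((1 + t) ^ 6)⁻¹ := by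
          field_simp
      _ ≤ 64 * C * A * (∫ x, ‖F x‖) * ((1 + t)⁻¹ * ((1 + t) ^ 2)⁻¹) := by gcongr
      _ ≤ _ := by gcongr
  · have hNl : 2 ^ N ≤ I.length := zpow_le_zpow_right₀ one_le_two hs.le
    have h3 : L / I.length ≤ (1 / 2 : ℝ) ^ (I.scale - N).natAbs := by
      rw [← DyadicInterval.inv_length_of_lt hs.le]
      gcongr
    calc _ ≤ (C * (Real.sqrt I.length)⁻¹ * (L / I.length) * ((1 + t) ^ 6)⁻¹ * ∫ x, ‖F x‖) *
          (A * Real.sqrt I.length) := by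
          gcongr
          exact hF.norm_vcoeff_le_of_large hC0 hC' (hN1.trans hNl)
      _ = 1 * C * A * (∫ x, ‖F x‖) * ((L / I.length) * ((1 + t) ^ 6)⁻¹) := by
          field_simp
      _ ≤ _ := by
          gcongr
          norm_num

end

/-- A function satisfying the Carleson condition has bounded mean oscillation. -/
theorem IsWaveletBasis.exists_osc_le_carleson {w : 𝓢(ℝ, ℂ)} (hw : IsWaveletBasis w) :
    ∃ C : ℝ, 0 < C ∧ ∀ (K : Type u) [NormedAddCommGroup K] [InnerProductSpace ℂ K] [CompleteSpace K]
      (f : ℝ → K) (A : ℝ), WeightedL2 f → 0 ≤ A → CarlesonBound w f A → OscBound f (C * A) := by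
  obtain ⟨C, hC0, hC, hC'⟩ := exists_decay w
  obtain ⟨C1, hC1, hsum⟩ := exists_sum_dyadicWeight_le (r := 1 / 2) (by norm_num) (by norm_num)
  refine ⟨4 + 64 * C * C1, by positivity, fun K _ _ _ f A hf hA h a b hab => ?_⟩
  set L := b - a with hLdef
  have hL : 0 < L := sub_pos.2 hab
  have hb : a + L = b := by rw [hLdef]; ring
  set m := avg f a b with hm
  set s := Set.Ioc a b with hs
  set F := s.indicator fun x => f x - m with hFdef
  have hFw : WeightedL2 fun x => f x - m := hf.sub_const m
  have hF2 : MemLp F 2 (volume : Measure ℝ) := hFw.memLp_Ioc a b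
  have hFi : IntegrableOn (fun x => f x - m) s := hFw.integrableOn a b
  have hmean : ∫ x, F x = 0 := by
    rw [hFdef, integral_indicator measurableSet_Ioc, integral_sub (hf.integrableOn a b)
      (integrableOn_const (by simp)), setIntegral_const, Real.volume_real_Ioc_of_le hab.le, hm,
      avg, smul_smul, mul_inv_cancel₀ hL.ne', one_smul, sub_self]
  have hF : IsLocalMeanZero F a L := by
    refine ⟨hFi.integrable_indicator measurableSet_Ioc, fun x hx => ?_, hmean⟩
    rw [hb]
    by_contra hxs
    exact hx (Set.indicator_of_notMem hxs _)
  set Q := ∫ x in s, ‖f x - m‖ ^ 2 with hQ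
  have hQ0 : 0 ≤ Q := integral_nonneg fun _ => by positivity
  have hFsq : ∫ x, ‖F x‖ ^ 2 = Q := by
    rw [hQ, ← integral_indicator measurableSet_Ioc]
    congr 1
    funext x
    by_cases hx : x ∈ s <;> simp [hFdef, ← hs, hx]
  have hX : ∫ x, ‖F x‖ ≤ Real.sqrt L * Real.sqrt Q := by
    have e : ∫ x, ‖F x‖ = ∫ x in s, ‖f x - m‖ := by
      rw [← integral_indicator measurableSet_Ioc]
      congr 1
      funext x
      by_cases hx : x ∈ s <;> simp [hFdef, ← hs, hx]
    rw [e]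
    exact setIntegral_norm_le_sqrt hab.le (hFw.memLp_restrict a b)
  -- On the interval `f = F + m`, and the constant `m` pairs to zero with `F`.
  have hinner : ∫ x, inner ℂ (F x) (f x) = (Q : ℂ) := by
    have h1 : ∀ x, inner ℂ (F x) (f x) = ((‖F x‖ ^ 2 : ℝ) : ℂ) + inner ℂ (F x) m := by
      intro x
      by_cases hx : x ∈ s
      · have : f x = F x + m := by simp [hFdef, hx]
        rw [this, inner_add_right, inner_self_eq_norm_sq_to_K]
        norm_cast
      · simp [hFdef, hx]
    have hi : Integrable fun x => inner ℂ (F x) m := hF.int.inner_const m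
    have h2 : ∫ x, inner ℂ (F x) m = 0 := by
      have h3 : ∀ x, inner ℂ (F x) m = conj (inner ℂ m (F x)) := fun x => (inner_conj_symm _ _).symm
      simp_rw [h3]
      rw [integral_conj, integral_inner hF.int, hmean, inner_zero_right, map_zero]
    simp_rw [h1]
    have hi0 : Integrable fun x => ((‖F x‖ ^ 2 : ℝ) : ℂ) :=
      ((memLp_two_iff_integrable_sq_norm hF2.1).1 hF2).ofReal
    rw [integral_add hi0 hi, h2, add_zero,
      integral_complex_ofReal, hFsq]
  obtain ⟨N, hN1, hN2⟩ := exists_zpow_near hL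
  have hbound : ∀ S : Finset DyadicInterval, ∑ I ∈ S, ‖vcoeff w F I‖ * ‖vcoeff w f I‖ ≤
      (4 + 64 * C * C1) * A * (Real.sqrt L * Real.sqrt Q) := by
    classical
    intro S
    rw [← Finset.sum_filter_add_sum_filter_not S (fun I => I.scale ≤ N ∧ |a - I.center| < 2 * L)]
    have hnear : ∑ I ∈ S with I.scale ≤ N ∧ |a - I.center| < 2 * L, ‖vcoeff w F I‖ * ‖vcoeff w f I‖ ≤
        4 * A * (Real.sqrt L * Real.sqrt Q) := by
      refine (Real.sum_mul_le_sqrt_mul_sqrt _ _ _).trans ?_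
      have h1 : ∑ I ∈ S with I.scale ≤ N ∧ |a - I.center| < 2 * L, ‖vcoeff w F I‖ ^ 2 ≤ Q := by
        rw [← hFsq]
        exact sum_le_hasSum _ (fun _ _ => sq_nonneg _) (hw.hasSum_norm_vcoeff_sq hF2)
      -- Five dyadic intervals of length `2 ^ N ≤ 2 * L` give `10 * A ^ 2 * L`, rounded up to a
      -- perfect square times `L`.
      have h2 : ∑ I ∈ S with I.scale ≤ N ∧ |a - I.center| < 2 * L, ‖vcoeff w f I‖ ^ 2 ≤
          (4 * A) ^ 2 * L := by
        refine (h.sum_near_le (a := a) hN1 fun I hI => (Finset.mem_filter.1 hI).2).trans ?_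
        nlinarith [sq_nonneg A]
      calc _ ≤ Real.sqrt Q * Real.sqrt ((4 * A) ^ 2 * L) := by gcongr
        _ = _ := by
            rw [Real.sqrt_mul (sq_nonneg _), Real.sqrt_sq (by positivity)]
            ring
    have hfar : ∑ I ∈ S with ¬ (I.scale ≤ N ∧ |a - I.center| < 2 * L),
        ‖vcoeff w F I‖ * ‖vcoeff w f I‖ ≤ 64 * C * C1 * A * (Real.sqrt L * Real.sqrt Q) := by
      calc _ ≤ ∑ I ∈ S with ¬ (I.scale ≤ N ∧ |a - I.center| < 2 * L),
            64 * C * A * (∫ x, ‖F x‖) * dyadicWeight (1 / 2) N a I := by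
            refine Finset.sum_le_sum fun I hI => ?_
            exact hF.norm_vcoeff_mul_le_far hL hC0 hC hC' h hA hN1 hN2 (Finset.mem_filter.1 hI).2
        _ ≤ 64 * C * A * (∫ x, ‖F x‖) * C1 := by
            rw [← Finset.mul_sum]
            have : 0 ≤ ∫ x, ‖F x‖ := integral_nonneg fun _ => norm_nonneg _
            gcongr
            exact hsum _ _ _
        _ ≤ 64 * C * A * (Real.sqrt L * Real.sqrt Q) * C1 := by gcongr
        _ = _ := by ring
    linarith
  have hQle : Q ≤ (4 + 64 * C * C1) * A * (Real.sqrt L * Real.sqrt Q) := by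
    have hS := hw.hasSum_inner_vcoeff_of_local hF hF2 hL hf
    rw [hinner] at hS
    have h1 := le_of_tendsto' hS.norm fun S => (norm_sum_le S _).trans
      ((Finset.sum_le_sum fun I _ => norm_inner_le_norm (𝕜 := ℂ) _ _).trans (hbound S))
    rwa [Complex.norm_real, Real.norm_of_nonneg hQ0] at h1
  have hroot : Real.sqrt Q ≤ (4 + 64 * C * C1) * A * Real.sqrt L := by
    rcases (Real.sqrt_nonneg Q).eq_or_lt with h0 | h0
    · rw [← h0]
      positivity
    · refine le_of_mul_le_mul_right ?_ h0
      rw [Real.mul_self_sqrt hQ0]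
      linarith
  calc Q = Real.sqrt Q ^ 2 := (Real.sq_sqrt hQ0).symm
    _ ≤ ((4 + 64 * C * C1) * A * Real.sqrt L) ^ 2 := by gcongr
    _ = _ := by rw [mul_pow, Real.sq_sqrt hL.le]

/-! ### Column operators -/

lemma volume_ac_wMeasure : (volume : Measure ℝ) ≪ wMeasure := by
  refine withDensity_absolutelyContinuous' (Measurable.aemeasurable (by fun_prop)) (ae_of_all _ fun x => ?_)
  rw [Ne, ENNReal.ofReal_eq_zero, not_le]
  positivity

lemma integral_wMeasure {E : Type*} [NormedAddCommGroup E] [NormedSpace ℝ E] (g : ℝ → E) :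
    ∫ x, g x ∂wMeasure = ∫ x, (1 + x ^ 2)⁻¹ • g x := by
  rw [wMeasure, integral_withDensity_eq_integral_toReal_smul (by fun_prop) (by simp)]
  congr 1
  funext x
  rw [ENNReal.toReal_ofReal (by positivity)]

section

variable {K : Type u} [NormedAddCommGroup K]

lemma weightedL2_coeFn (f : Lp K 2 wMeasure) : WeightedL2 (f : ℝ → K) := by
  refine ⟨(Lp.aestronglyMeasurable f).mono_ac volume_ac_wMeasure, ?_⟩
  have h := (memLp_two_iff_integrable_sq_norm (Lp.aestronglyMeasurable f)).1 (Lp.memLp f)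
  have h' := (integrable_withDensity_iff_integrable_smul' (μ := volume)
    (f := fun x : ℝ => ENNReal.ofReal (1 + x ^ 2)⁻¹) (by fun_prop) (by simp)).1 h
  refine h'.congr (ae_of_all _ fun x => ?_)
  simp only
  rw [ENNReal.toReal_ofReal (by positivity), smul_eq_mul, mul_comm]

variable [InnerProductSpace ℂ K] [CompleteSpace K]

omit [CompleteSpace K] in
-- The factor `1 + x²` cancels the density, so pairings with weighted test functions become
-- integrals against `dx`.
lemma integral_toLp_smul {g : ℝ → ℂ} (hg : MemLp (fun x : ℝ => ((1 + x ^ 2 : ℝ) : ℂ) * g x) 2 wMeasure)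
    (f : ℝ → K) : ∫ x, hg.toLp _ x • f x ∂wMeasure = ∫ x, g x • f x := by
  have h1 : ∫ x, hg.toLp _ x • f x ∂wMeasure = ∫ x, (((1 + x ^ 2 : ℝ) : ℂ) * g x) • f x ∂wMeasure := by
    refine integral_congr_ae ?_
    filter_upwards [hg.coeFn_toLp] with x hx
    rw [hx]
  rw [h1, integral_wMeasure]
  congr 1
  funext x
  have hx : (1 + x ^ 2 : ℝ) ≠ 0 := by positivity
  rw [mul_smul, Complex.coe_smul ((1 + x ^ 2 : ℝ)), smul_smul, inv_mul_cancel₀ hx, one_smul]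

variable {M : VonNeumannAlgebra K} {φ : WeakFun M}

lemma coeff_apply (w : 𝓢(ℝ, ℂ)) (hφ : φ ∈ columnL2 M) (I : DyadicInterval) (h : K) :
    coeff w φ I h = vcoeff w (columnOp φ h) I := by
  rw [coeff, columnOp_spec hφ, integral_toLp_smul (memLp_weight_wavelet w I), vcoeff]

lemma mean_apply (hφ : φ ∈ columnL2 M) (a b : ℝ) (h : K) :
    mean φ a b h = avg (columnOp φ h) a b := by
  rw [mean, smul_apply, columnOp_spec hφ,
    integral_toLp_smul (memLp_weight_indicator a b), avg, ← integral_indicator measurableSet_Ioc]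
  congr 2
  funext x
  by_cases hx : x ∈ Set.Ioc a b <;> simp [hx]

omit [CompleteSpace K] in
lemma norm_sq_eq_integral {μ : Measure ℝ} (f : Lp K 2 μ) : ‖f‖ ^ 2 = ∫ x, ‖f x‖ ^ 2 ∂μ := by
  have h : ((‖f‖ ^ 2 : ℝ) : ℂ) = ((∫ x, ‖f x‖ ^ 2 ∂μ : ℝ) : ℂ) := by
    rw [← integral_complex_ofReal]
    push_cast
    have := inner_self_eq_norm_sq_to_K (𝕜 := ℂ) f
    rw [L2.inner_def] at this
    simp_rw [inner_self_eq_norm_sq_to_K] at this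
    exact this.symm
  exact_mod_cast h

lemma norm_oscOp_sq (hφ : φ ∈ columnL2 M) (a b : ℝ) (h : K) :
    ‖oscOp φ a b h‖ ^ 2 =
      ∫ x in Set.Ioc a b, ‖columnOp φ h x - avg (columnOp φ h) a b‖ ^ 2 := by
  rw [norm_sq_eq_integral]
  refine integral_congr_ae ?_
  have h1 : oscOp φ a b h = (memLp_restrict_Ioc (columnOp φ h) a b).toLp _ -
      Lp.const 2 (volume.restrict (Set.Ioc a b)) (mean φ a b h) := rfl
  rw [h1]
  filter_upwards [Lp.coeFn_sub ((memLp_restrict_Ioc (columnOp φ h) a b).toLp _)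
      (Lp.const 2 (volume.restrict (Set.Ioc a b)) (mean φ a b h)),
    (memLp_restrict_Ioc (columnOp φ h) a b).coeFn_toLp,
    Lp.coeFn_const (p := 2) (μ := volume.restrict (Set.Ioc a b)) (mean φ a b h)] with x hx1 hx2 hx3
  rw [hx1, Pi.sub_apply, hx2, hx3, Function.const_apply, mean_apply hφ]

/-- Since `⟨T h, h⟩ = ‖√T h‖²`, the norm is tested on single vectors. This turns operator valued
norms into estimates for `K`-valued functions. -/
lemma enorm_sqrt_le_iff {T : K →L[ℂ] K} (hT : 0 ≤ T) (B : ℝ≥0) :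
    ‖CFC.sqrt T‖ₑ ≤ B ↔ ∀ h, (inner ℂ (T h) h).re ≤ (B * ‖h‖) ^ 2 := by
  have hsq : ∀ h, (inner ℂ (T h) h).re = ‖CFC.sqrt T h‖ ^ 2 := by
    intro h
    have hsa : ContinuousLinearMap.adjoint (CFC.sqrt T) = CFC.sqrt T :=
      (IsSelfAdjoint.of_nonneg (CFC.sqrt_nonneg T)).star_eq
    have h1 : T h = CFC.sqrt T (CFC.sqrt T h) := by
      conv_lhs => rw [← CFC.sqrt_mul_sqrt_self T hT]
      rfl
    have h2 : inner ℂ (T h) h = inner ℂ (CFC.sqrt T h) (CFC.sqrt T h) := by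
      rw [h1]
      conv_rhs => rw [← hsa, ContinuousLinearMap.adjoint_inner_right, hsa]
    rw [h2, inner_self_eq_norm_sq_to_K]
    norm_cast
  simp_rw [hsq]
  rw [enorm_le_coe, ← NNReal.coe_le_coe, coe_nnnorm,
    ContinuousLinearMap.opNorm_le_iff B.coe_nonneg]
  refine forall_congr' fun h => ?_
  exact (pow_le_pow_iff_left₀ (norm_nonneg _) (by positivity) two_ne_zero).symm

/-- The vector `φ_I h` is the mean of the column `φ(·) h`, so the quadratic form of `oscSq` at `h`
is the oscillation integral of that column. -/
lemma oscNormC_le_iff (hφ : φ ∈ columnL2 M) (D : ℝ≥0) :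
    oscNormC φ ≤ D ↔ ∀ h, OscBound (columnOp φ h) (D * ‖h‖) := by
  have key : ∀ a b : ℝ, a < b → (‖CFC.sqrt ((b - a)⁻¹ • oscSq φ a b)‖ₑ ≤ D ↔
      ∀ h, ∫ x in Set.Ioc a b, ‖columnOp φ h x - avg (columnOp φ h) a b‖ ^ 2 ≤
        (D * ‖h‖) ^ 2 * (b - a)) := by
    intro a b hab
    have h0 : 0 < b - a := sub_pos.2 hab
    have hpos : 0 ≤ oscSq φ a b := by
      rw [ContinuousLinearMap.nonneg_iff_isPositive]
      exact ContinuousLinearMap.isPositive_adjoint_comp_self _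
    rw [enorm_sqrt_le_iff (smul_nonneg (inv_nonneg.2 h0.le) hpos)]
    refine forall_congr' fun h => ?_
    have : (inner ℂ (((b - a)⁻¹ • oscSq φ a b) h) h).re = (b - a)⁻¹ * ‖oscOp φ a b h‖ ^ 2 := by
      rw [smul_apply, ← Complex.coe_smul, inner_smul_left, Complex.conj_ofReal,
        Complex.re_ofReal_mul, oscSq, ContinuousLinearMap.comp_apply,
        ContinuousLinearMap.adjoint_inner_left, inner_self_eq_norm_sq_to_K]
      norm_cast
    rw [this, norm_oscOp_sq hφ, inv_mul_le_iff₀ h0, mul_comm (b - a)]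
  simp only [oscNormC, iSup_le_iff]
  constructor
  · intro H h a b hab
    exact (key a b hab).1 (H a b hab) h
  · intro H a b hab
    exact (key a b hab).2 fun h => H h a b hab

lemma waveletNormC_le_iff (w : 𝓢(ℝ, ℂ)) (hφ : φ ∈ columnL2 M) (A : ℝ≥0) :
    waveletNormC w φ ≤ A ↔ ∀ h, CarlesonBound w (columnOp φ h) (A * ‖h‖) := by
  have key : ∀ (J : DyadicInterval) (S : Finset DyadicInterval),
      (‖CFC.sqrt (J.length⁻¹ • ∑ I ∈ S, star (coeff w φ I) * coeff w φ I)‖ₑ ≤ A ↔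
      ∀ h, ∑ I ∈ S, ‖vcoeff w (columnOp φ h) I‖ ^ 2 ≤ (A * ‖h‖) ^ 2 * J.length) := by
    intro J S
    have h0 := J.length_pos
    have hpos : 0 ≤ ∑ I ∈ S, star (coeff w φ I) * coeff w φ I :=
      Finset.sum_nonneg fun I _ => star_mul_self_nonneg _
    rw [enorm_sqrt_le_iff (smul_nonneg (inv_nonneg.2 h0.le) hpos)]
    refine forall_congr' fun h => ?_
    have : (inner ℂ ((J.length⁻¹ • ∑ I ∈ S, star (coeff w φ I) * coeff w φ I) h) h).re =
        J.length⁻¹ * ∑ I ∈ S, ‖vcoeff w (columnOp φ h) I‖ ^ 2 := by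
      rw [smul_apply, ← Complex.coe_smul, inner_smul_left, Complex.conj_ofReal,
        Complex.re_ofReal_mul, sum_apply, sum_inner, Complex.re_sum]
      congr 1
      refine Finset.sum_congr rfl fun I _ => ?_
      rw [← coeff_apply w hφ, mul_apply_eq_comp, ContinuousLinearMap.star_eq_adjoint,
        ContinuousLinearMap.adjoint_inner_left, inner_self_eq_norm_sq_to_K]
      norm_cast
    rw [this, inv_mul_le_iff₀ h0, mul_comm J.length]
  simp only [waveletNormC, iSup_le_iff]
  constructor
  · intro H h J S hS
    exact (key J S).1 (H J S hS) h
  · intro H J S hS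
    exact (key J S).2 fun h => H h J S hS

end

/-- The wavelet norm and the mean oscillation norm are equivalent on the column space. -/
theorem IsWaveletBasis.exists_norm_equiv {w : 𝓢(ℝ, ℂ)} (hw : IsWaveletBasis w) :
    ∃ c : ℝ≥0, 0 < c ∧ ∀ (K : Type u) [NormedAddCommGroup K] [InnerProductSpace ℂ K] [CompleteSpace K]
      (M : VonNeumannAlgebra K) (φ : WeakFun M), φ ∈ columnL2 M →
        oscNormC φ ≤ c * waveletNormC w φ ∧ waveletNormC w φ ≤ c * oscNormC φ := by
  obtain ⟨C, hC, h1⟩ := hw.exists_osc_le_carleson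
  obtain ⟨C', hC', h2⟩ := hw.exists_carleson_le_osc
  -- The root appears because `C'` compares squares, whereas `C` compares the norms themselves.
  set c : ℝ≥0 := ⟨max C (Real.sqrt C'), hC.le.trans (le_max_left _ _)⟩ with hc
  have hc0 : 0 < c := NNReal.coe_pos.1 (hC.trans_le (le_max_left _ _))
  have hc1 : C ≤ c := le_max_left _ _
  have hc2 : C' ≤ (c : ℝ) ^ 2 :=
    (Real.sqrt_le_left c.2).1 (le_max_right C (Real.sqrt C'))
  -- With `c ≠ 0` the inequality is trivial when the norm on the right is infinite.
  have htop : (c : ℝ≥0∞) * ∞ = ∞ := ENNReal.mul_top (ENNReal.coe_ne_zero.2 hc0.ne')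
  refine ⟨c, hc0, fun K _ _ _ M φ hφ => ⟨?_, ?_⟩⟩
  · rcases eq_or_ne (waveletNormC w φ) ∞ with h | h
    · rw [h, htop]
      exact le_top
    · lift waveletNormC w φ to ℝ≥0 using h with A hA
      have hA' := (waveletNormC_le_iff w hφ A).1 hA.ge
      rw [← ENNReal.coe_mul, oscNormC_le_iff hφ]
      intro h a b hab
      refine (h1 K _ _ (weightedL2_coeFn _) (by positivity) (hA' h) a b hab).trans ?_
      have : 0 ≤ b - a := sub_nonneg.2 hab.le
      rw [NNReal.coe_mul, mul_assoc]
      gcongr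
  · rcases eq_or_ne (oscNormC φ) ∞ with h | h
    · rw [h, htop]
      exact le_top
    · lift oscNormC φ to ℝ≥0 using h with D hD
      have hD' := (oscNormC_le_iff hφ D).1 hD.ge
      rw [← ENNReal.coe_mul, waveletNormC_le_iff w hφ]
      intro h J S hS
      refine (h2 K _ _ (weightedL2_coeFn _) (by positivity) (hD' h) J S hS).trans ?_
      have := J.length_pos
      rw [NNReal.coe_mul, mul_assoc (c : ℝ), mul_pow (c : ℝ)]
      gcongr

lemma lt_top_iff_of_le_mul {x y : ℝ≥0∞} {c : ℝ≥0} (h1 : x ≤ c * y) (h2 : y ≤ c * x) :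
    y < ∞ ↔ x < ∞ :=
  ⟨fun h => h1.trans_lt (ENNReal.mul_lt_top ENNReal.coe_lt_top h),
    fun h => h2.trans_lt (ENNReal.mul_lt_top ENNReal.coe_lt_top h)⟩

end OpBMO

theorem mainTheorem9 (w : 𝓢(ℝ, ℂ)) (hw : OpBMO.IsWaveletBasis w) :
    ∃ c : ℝ≥0, 0 < c ∧
      ∀ (K : Type u) [NormedAddCommGroup K] [InnerProductSpace ℂ K] [CompleteSpace K]
        (M : VonNeumannAlgebra K),
        (OpBMO.waveletBMOC w M = OpBMO.oscBMOC M ∧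
          ∀ φ ∈ OpBMO.oscBMOC M,
            OpBMO.oscNormC φ ≤ c * OpBMO.waveletNormC w φ ∧
            OpBMO.waveletNormC w φ ≤ c * OpBMO.oscNormC φ) ∧
        (OpBMO.waveletBMOR w M = OpBMO.oscBMOR M ∧
          ∀ φ ∈ OpBMO.oscBMOR M,
            OpBMO.oscNormR φ ≤ c * OpBMO.waveletNormR w φ ∧
            OpBMO.waveletNormR w φ ≤ c * OpBMO.oscNormR φ) ∧
        (OpBMO.waveletBMO w M = OpBMO.oscBMO M ∧
          ∀ φ ∈ OpBMO.oscBMO M,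
            OpBMO.oscNorm φ ≤ c * OpBMO.waveletNorm w φ ∧
            OpBMO.waveletNorm w φ ≤ c * OpBMO.oscNorm φ) := by
  obtain ⟨c, hc, h⟩ := hw.exists_norm_equiv
  refine ⟨c, hc, fun K _ _ _ M => ?_⟩
  have hC : OpBMO.waveletBMOC w M = OpBMO.oscBMOC M := by
    ext φ
    exact and_congr_right fun hφ =>
      OpBMO.lt_top_iff_of_le_mul (h K M φ hφ).1 (h K M φ hφ).2
  -- The row statement is the column statement for `adj φ`.
  have hR : OpBMO.waveletBMOR w M = OpBMO.oscBMOR M := by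
    ext φ
    exact and_congr_right fun hφ =>
      OpBMO.lt_top_iff_of_le_mul (h K M _ hφ).1 (h K M _ hφ).2
  refine ⟨⟨hC, fun φ hφ => h K M φ hφ.1⟩, ⟨hR, fun φ hφ => h K M _ hφ.1⟩, ?_, fun φ hφ => ?_⟩
  · rw [OpBMO.waveletBMO, OpBMO.oscBMO, hC, hR]
  · obtain ⟨h1, h2⟩ := h K M φ hφ.1.1
    obtain ⟨h3, h4⟩ := h K M _ hφ.2.1
    constructor
    · exact max_le (h1.trans (by gcongr; exact le_max_left _ _))
        (h3.trans (by gcongr; exact le_max_right _ _))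
    · exact max_le (h2.trans (by gcongr; exact le_max_left _ _))
        (h4.trans (by gcongr; exact le_max_right _ _))
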